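/- **Setting.** Let $H$ be a real Hilbert space with inner product $\langle\cdot,\cdot\rangle$ and norm $\|\cdot\|$, and $V$ a Banach space with $D(A)\subset V\subset H$, where $V\hookrightarrow H$ is continuous and $A:D(A)\to H$ is a densely defined linear operator whose domain (with the graph norm) is compactly embedded in $H$. For $\lambda$ in a neighbourhood $\Lambda$ of $\lambda_c\in\mathbb R$ let $P_\lambda:V\to H$ be bounded linear operators depending continuously (in operator norm) on $\lambda$, and $L_\lambda=-A+P_\lambda$ with domain $D(A)$. Fix $\lambda^*>\lambda_c$ with $[\lambda_c,\lambda^*]\subset\Lambda$. Assume: * $L_\lambda$ is self-adjoint for $\lambda\in\Lambda$; $\beta_1(\lambda)\ge\beta_2(\lambda)\ge\cdots$ denote its eigenvalues, with multiplicity, and $(e_n)_{n\ge1}=(e_n(\lambda))_{n\ge 1}$ an associated complete orthonormal system of eigenvectors. * For $\lambda\in\Lambda$, $\beta_1(\lambda)$ is $<0$, $=0$, $>0$ according as $\lambda<\lambda_c$, $\lambda=\lambda_c$, $\lambda>\lambda_c$; and $\beta_j(\lambda)<0$ for all $j\ge2$ and $\lambda\in[\lambda_c,\lambda^*]$. * $B:V\times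 V\to H$ is continuous bilinear with $\langle B(u,u),u\rangle=0$ for $u\in V$, and there is $N\ge1$ such that, for every $\lambda\in[\lambda_c,\lambda^*]$, $B_{11}^n=0$ for all $n>N$, while $B_{11}^n\ne0$ for at least one $2\le n\le N$, where $B_{ij}^n=\langle B(e_i,e_j),e_n\rangle$. Write $\epsilon=\beta_1(\lambda)$ and $\sigma=\sqrt{\epsilon}$, let $\Pi_{\mathfrak s}u=u-\langle u,e_1\rangle e_1$, $\Pi_1u=\langle u,e_1\rangle$, $L^{\mathfrak s}_\lambda=\Pi_{\mathfrak s}L_\lambda$, $B_{11}^{\mathfrak s}=\Pi_{\mathfrak s}B(e_1,e_1)$, and $$\mathcal F_{\mathfrak c}(v)=\Pi_1\big(B(e_1,v)+B(v,e_1)\big),\qquad \mathcal F_{\mathfrak s}(v)=\Pi_{\mathfrak s}\big(B(e_1,v)+B(v,e_1)\big).$$ Let $(W_t)_{t\in\mathbb R}$ be a two-sided standard Brownian motion on a probability space $(\Omega,\mathbb P)$, and $$M_{11}^{n,\lambda}(t)=\int_{-\infty}^0e^{(2\epsilon-\beta_n(\lambda))s+\sigma(W_{t+s}-W_t)}\,ds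 .$$ Assume the dissipation condition: for every $\lambda\in[\lambda_c,\lambda^*]$, almost surely, $\sum_{n=2}^NB_{11}^nM_{11}^{n,\lambda}(t)(B_{1n}^1+B_{n1}^1)<0$ for all $t\ge0$. **Surrogate system.** For $X_0\in\mathbb R$ let $(X,\Phi)$, with $X$ real-valued and $\Phi$ with values in $\{v\in V:\langle v,e_1\rangle=0\}$, solve $$dX=\big(\epsilon X+X\mathcal F_{\mathfrak c}(\Phi)\big)dt+\sigma X\circ dW_t,\qquad d\Phi=\big(L_\lambda^{\mathfrak s}\Phi+X^2B_{11}^{\mathfrak s}+2\Phi\mathcal F_{\mathfrak c}(\Phi)\big)dt+\sigma\Phi\circ dW_t,\quad t\ge 0,$$ $$X(0)=X_0,\qquad \Phi(0)=\sum_{n=2}^NB_{11}^nM_{11}^{n,\lambda}(0)X_0^2\,e_n .$$ Here a solution of a Stratonovich equation $du=(Lu+F(u))\,dt+\sigma u\circ dW_t$ is understood in the sense that, almost surely, $v=e^{-Z}u$ is a classical solution of $v'=Lv+Zv+e^{-Z}F(e^{Z}v)$, where $Z$ is the stationary Ornstein–Uhlenbeck process solving $dZ=-Z\,dt+\sigma\,dW_t$;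 classical means that the components of $v$ are continuous on $[0,\infty)$ (in $\mathbb R$, resp. $V$) and, on $(0,\infty)$, differentiable with respect to time (in $\mathbb R$, resp. $H$), the second component being moreover continuous with values in $D(A)$. **Residual.** With $E_1=X\mathcal F_{\mathfrak c}(\Phi)+\Pi_1B(\Phi,\Phi)$ and $E_2=X^2B_{11}^{\mathfrak s}+X\mathcal F_{\mathfrak s}(\Phi)+\Pi_{\mathfrak s}B(\Phi,\Phi)$ put $$\mathcal R_1(t)=X(t)-e^{\epsilon t+\sigma W_t}X(0)-\int_0^te^{\epsilon(t-s)+\sigma(W_t-W_s)}E_1(s)\,ds,$$ $$\mathcal R_2(t)=\Phi(t)-e^{tL_\lambda^{\mathfrak s}+\sigma W_t}\Phi(0)-\int_0^te^{(t-s)L_\lambda^{\mathfrak s}+\sigma(W_t-W_s)}E_2(s)\,ds ,$$ where $e^{tL^{\mathfrak s}_\lambda}u=\sum_{n\ge2}e^{\beta_n(\lambda)t}\langle u,e_n\rangle e_n$. **Theorem.** For every $c\in\mathbb R$, every $T>0$ and every $\chi\in(0,1)$ there is a constant $C>0$ such that, for all $\lambda\in(\lambda_c,\lambda^*]$ (so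 that $C$ is independent of $\epsilon=\beta_1(\lambda)>0$), all $X_0$ with $|X_0|\le c\sqrt\epsilon$, and all solutions $(X,\Phi)$ as above, $$\mathbb P\Big(\sup_{t\in[0,T/\epsilon]}|\mathcal R_1(t)|\le C\epsilon\Big)\ge1-\chi\qquad\text{and}\qquad \mathbb P\Big(\sup_{t\in[0,T/\epsilon]}\|\mathcal R_2(t)\|\le C\epsilon^{3/2}\Big)\ge1-\chi .$$ -/

import Mathlib

open MeasureTheory ProbabilityTheory Set Filter Topology
open scoped NNReal InnerProductSpace

noncomputable section

namespace Pitchfork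

/-- The unbounded operator `-A + Q` of `H`, with domain `D(A)`, where `Q` is a bounded operator
from an intermediate space `V` to `H` and `incl` is the inclusion of `D(A)` into `V`. -/
def perturbedOp {H V : Type*} [NormedAddCommGroup H] [InnerProductSpace ℝ H]
    [NormedAddCommGroup V] [NormedSpace ℝ V]
    (A : H →ₗ.[ℝ] H) (incl : A.domain →ₗ[ℝ] V) (Q : V →L[ℝ] H) : H →ₗ.[ℝ] H where
  domain := A.domain
  toFun := -A.toFun + Q.toLinearMap ∘ₗ incl

/-- Data and standing assumptions of the pitchfork scenario, for `L_lam = -A + P_lam` and a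
quadratic nonlinearity `B`.

The eigenmodes are numbered from `0`: mode `0` is the critical one (usually written `e₁`, with
eigenvalue `β₁`), and the modes `1, 2, …` are the stable ones (usually written `e₂, e₃, …`). -/
structure Setting (H V : Type*)
    [NormedAddCommGroup H] [InnerProductSpace ℝ H] [CompleteSpace H]
    [NormedAddCommGroup V] [NormedSpace ℝ V] [CompleteSpace V] where
  /-- the leading linear operator -/
  A : H →ₗ.[ℝ] H
  dense_domain : Dense (A.domain : Set H)
  /-- `D(A)`, with its graph norm, is compactly embedded in `H` -/
  compact_domain : IsCompact (closure {x : H | ∃ u : A.domain, (u : H) = x ∧ ‖x‖ ≤ 1 ∧ ‖A u‖ ≤ 1})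
  /-- the continuous embedding of `V` into `H` -/
  emb : V →L[ℝ] H
  emb_injective : Function.Injective emb
  /-- the inclusion of `D(A)` into `V` -/
  incl : A.domain →ₗ[ℝ] V
  emb_incl : ∀ u : A.domain, emb (incl u) = (u : H)
  /-- the range of the control parameter -/
  Lam : Set ℝ
  lamC : ℝ
  lamStar : ℝ
  lamC_lt : lamC < lamStar
  Lam_nhds : Lam ∈ 𝓝 lamC
  Icc_subset : Icc lamC lamStar ⊆ Lam
  /-- the lower-order part of the linear operator, continuous in the parameter -/
  P : ℝ → V →L[ℝ] H
  P_continuous : ContinuousOn P Lam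
  /-- `L_lam` is self-adjoint -/
  selfAdjoint : ∀ lam ∈ Lam, IsSelfAdjoint (perturbedOp A incl (P lam))
  /-- the eigenvalues of `L_lam`, in decreasing order and repeated with multiplicity -/
  β : ℝ → ℕ → ℝ
  /-- the normalized eigenmodes of `L_lam` -/
  e : ℝ → ℕ → A.domain
  β_antitone : ∀ lam ∈ Lam, Antitone (β lam)
  eigen : ∀ lam ∈ Lam, ∀ n, perturbedOp A incl (P lam) (e lam n) = β lam n • (e lam n : H)
  e_orthonormal : ∀ lam ∈ Lam, Orthonormal ℝ (fun n => (e lam n : H))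
  e_complete : ∀ lam ∈ Lam, Dense (Submodule.span ℝ (range fun n => (e lam n : H)) : Set H)
  /-- exchange of stabilities: the critical eigenvalue -/
  critical_neg : ∀ lam ∈ Lam, lam < lamC → β lam 0 < 0
  critical_zero : β lamC 0 = 0
  critical_pos : ∀ lam ∈ Lam, lamC < lam → 0 < β lam 0
  /-- exchange of stabilities: the other eigenvalues -/
  stable_neg : ∀ lam ∈ Icc lamC lamStar, ∀ n, 1 ≤ n → β lam n < 0
  /-- the continuous bilinear map giving the nonlinearity `B(u, u)` -/
  B : V →L[ℝ] V →L[ℝ] H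
  energy : ∀ u : V, ⟪B u u, emb u⟫_ℝ = 0
  /-- number of modes reached by `B(e₁, e₁)`; the stable ones among them are `1, …, N - 1` -/
  N : ℕ
  one_le_N : 1 ≤ N
  interaction_zero : ∀ lam ∈ Icc lamC lamStar, ∀ n, N ≤ n →
    ⟪B (incl (e lam 0)) (incl (e lam 0)), (e lam n : H)⟫_ℝ = 0
  interaction_ne : ∀ lam ∈ Icc lamC lamStar, ∃ n, 1 ≤ n ∧ n < N ∧
    ⟪B (incl (e lam 0)) (incl (e lam 0)), (e lam n : H)⟫_ℝ ≠ 0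

namespace Setting

variable {H V : Type*} [NormedAddCommGroup H] [InnerProductSpace ℝ H] [CompleteSpace H]
  [NormedAddCommGroup V] [NormedSpace ℝ V] [CompleteSpace V] (S : Setting H V) (lam : ℝ)

/-- The linear operator `L_lam = -A + P_lam`, with domain `D(A)`. -/
def L (u : S.A.domain) : H := perturbedOp S.A S.incl (S.P lam) u

/-- The distance `ε` to criticality, i.e. the critical eigenvalue. -/
def eps : ℝ := S.β lam 0

/-- The eigenmodes as elements of `V`. -/
def eV (n : ℕ) : V := S.incl (S.e lam n)

/-- The interaction coefficients `⟨B(e_i, e_j), e_n⟩`. -/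
def Bcoef (n i j : ℕ) : ℝ := ⟪S.B (S.eV lam i) (S.eV lam j), (S.e lam n : H)⟫_ℝ

/-- The amplitude of `u` along the critical mode. -/
def Pi1 (u : H) : ℝ := ⟪u, (S.e lam 0 : H)⟫_ℝ

/-- The projector onto the stable modes. -/
def Pis (u : H) : H := u - S.Pi1 lam u • (S.e lam 0 : H)

/-- `F_c(v) = ⟨B(e₁, v) + B(v, e₁), e₁⟩`. -/
def Fc (v : V) : ℝ := S.Pi1 lam (S.B (S.eV lam 0) v + S.B v (S.eV lam 0))

/-- `F_s(v) = Π_s (B(e₁, v) + B(v, e₁))`. -/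
def Fs (v : V) : H := S.Pis lam (S.B (S.eV lam 0) v + S.B v (S.eV lam 0))

/-- `B₁₁ˢ = Π_s B(e₁, e₁)`. -/
def B11s : H := S.Pis lam (S.B (S.eV lam 0) (S.eV lam 0))

/-- The semigroup `exp (t Lˢ)` generated by the stable part of the self-adjoint operator `L_lam`,
through its spectral resolution. -/
def expLs (t : ℝ) (u : H) : H :=
  ∑' n : ℕ, (Real.exp (S.β lam (n + 1) * t) * ⟪u, (S.e lam (n + 1) : H)⟫_ℝ) • (S.e lam (n + 1) : H)

/-- The memory coefficient `M₁₁ⁿ(t)` along a noise path `w : ℝ → ℝ` (defined for all real times). -/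
def M (σ : ℝ) (w : ℝ → ℝ) (n : ℕ) (t : ℝ) : ℝ :=
  ∫ s in Iic (0 : ℝ), Real.exp ((2 * S.eps lam - S.β lam n) * s + σ * (w (t + s) - w t))

/-- The parameterization `Φ(X, t) = ∑_n B₁₁ⁿ M₁₁ⁿ(t) X² e_n` of the stable modes. -/
def param (σ : ℝ) (w : ℝ → ℝ) (x t : ℝ) : V :=
  ∑ n ∈ Finset.Ico 1 S.N, (S.Bcoef lam n 0 0 * S.M lam σ w n t * x ^ 2) • S.eV lam n

/-- The dissipation condition on the cubic coefficient of the reduced equation, along a noise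
path, for the nonnegative times. -/
def Dissipative (σ : ℝ) (w : ℝ → ℝ) : Prop :=
  ∀ t, 0 ≤ t → ∑ n ∈ Finset.Ico 1 S.N,
    S.Bcoef lam n 0 0 * S.M lam σ w n t * (S.Bcoef lam 0 0 n + S.Bcoef lam 0 n 0) < 0

end Setting

/-- A two-sided standard Brownian motion: `W_t` and `W_{-t}`, `t ≥ 0`, are independent standard
Brownian motions. -/
structure IsTwoSidedBrownian {Ω : Type*} [MeasurableSpace Ω] (W : ℝ → Ω → ℝ) (Pr : Measure Ω) :
    Prop where
  forward : IsBrownianReal (fun t : ℝ≥0 => W t) Pr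
  backward : IsBrownianReal (fun t : ℝ≥0 => W (-(t : ℝ))) Pr
  indep : IndepFun (fun ω (t : ℝ≥0) => W t ω) (fun ω (t : ℝ≥0) => W (-(t : ℝ)) ω) Pr

/-- The stationary Ornstein-Uhlenbeck process, i.e. the stationary solution of
`dr = -r dt + σ dW`, along a noise path: `Z(t) = σ ∫_{-∞}^t e^{-(t-s)} dW_s`, integrated by
parts. -/
def ouPath (σ : ℝ) (w : ℝ → ℝ) (t : ℝ) : ℝ :=
  -σ * ∫ s in Iic (0 : ℝ), Real.exp s * (w (t + s) - w t)

namespace Setting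

variable {H V : Type*} [NormedAddCommGroup H] [InnerProductSpace ℝ H] [CompleteSpace H]
  [NormedAddCommGroup V] [NormedSpace ℝ V] [CompleteSpace V] (S : Setting H V) (lam : ℝ)

/-- `(x, φ)` solves, along the noise path `w` and on `[0, ∞)`, the Stratonovich system
`dX = (ε X + X F_c(Φ)) dt + σ X ∘ dW`,
`dΦ = (Lˢ Φ + X² B₁₁ˢ + 2 Φ F_c(Φ)) dt + σ Φ ∘ dW`.

As usual for such equations `du = (L u + F(u)) dt + σ u ∘ dW`, a solution is a process `u` for
which `v = e^{-Z} u` is a classical solution of `v' = L v + Z v + e^{-Z} F(e^Z v)`, where `Z` is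
the stationary Ornstein-Uhlenbeck process; classical means in
`C((0, ∞); D(A)) ∩ C([0, ∞); V) ∩ C¹((0, ∞); H)`. -/
structure IsPathSolution (σ : ℝ) (w : ℝ → ℝ) (x : ℝ → ℝ) (φ : ℝ → V) : Prop where
  /-- `φ` takes its values in the stable subspace -/
  stable : ∀ t, 0 ≤ t → S.Pi1 lam (S.emb (φ t)) = 0
  continuous_x : ContinuousOn (fun t => Real.exp (-ouPath σ w t) * x t) (Ici 0)
  continuous_φ : ContinuousOn (fun t => Real.exp (-ouPath σ w t) • φ t) (Ici 0)
  eq_x : ∀ t, 0 < t →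
    let Z := ouPath σ w t
    let U := Real.exp (-Z) * x t
    let Ψ := Real.exp (-Z) • φ t
    HasDerivAt (fun r => Real.exp (-ouPath σ w r) * x r)
      (S.eps lam * U + Z * U + Real.exp Z * (U * S.Fc lam Ψ)) t
  eq_φ : ∃ ψ : ℝ → S.A.domain,
    (∀ t, 0 < t → S.incl (ψ t) = Real.exp (-ouPath σ w t) • φ t) ∧
    ContinuousOn (fun t => S.A (ψ t)) (Ioi 0) ∧
    ∀ t, 0 < t →
      let Z := ouPath σ w t
      let U := Real.exp (-Z) * x t
      let Ψ := Real.exp (-Z) • φ t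
      HasDerivAt (fun r => S.emb (Real.exp (-ouPath σ w r) • φ r))
        (S.Pis lam (S.L lam (ψ t)) + Z • S.emb Ψ
          + Real.exp Z • (U ^ 2 • S.B11s lam + (2 * S.Fc lam Ψ) • S.emb Ψ)) t

/-- `(X, Φ)` solves the Markovianized surrogate system, from `X(0) = X₀` and with `Φ` initialized
on the parameterization, for almost every noise realization. -/
def IsSurrogateSolution {Ω : Type*} [MeasurableSpace Ω] (Pr : Measure Ω) (W : ℝ → Ω → ℝ)
    (σ X₀ : ℝ) (X : ℝ → Ω → ℝ) (Φ : ℝ → Ω → V) : Prop :=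
  ∀ᵐ ω ∂Pr, S.IsPathSolution lam σ (W · ω) (X · ω) (Φ · ω) ∧
    X 0 ω = X₀ ∧ Φ 0 ω = S.param lam σ (W · ω) X₀ 0

/-- Nonlinear part of the critical component of the SPDE. -/
def E1 (x : ℝ) (y : V) : ℝ := x * S.Fc lam y + S.Pi1 lam (S.B y y)

/-- Nonlinear part of the stable component of the SPDE. -/
def E2 (x : ℝ) (y : V) : H := x ^ 2 • S.B11s lam + x • S.Fs lam y + S.Pis lam (S.B y y)

/-- The critical component of the residual of `(x, y)` in the mild form of the split SPDE, along a
noise path `w`. -/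
def R1 (σ : ℝ) (w : ℝ → ℝ) (x : ℝ → ℝ) (y : ℝ → V) (t : ℝ) : ℝ :=
  x t - Real.exp (S.eps lam * t + σ * w t) * x 0
    - ∫ s in (0 : ℝ)..t,
        Real.exp (S.eps lam * (t - s) + σ * (w t - w s)) * S.E1 lam (x s) (y s)

/-- The stable component of the residual of `(x, y)` in the mild form of the split SPDE, along a
noise path `w`. -/
def R2 (σ : ℝ) (w : ℝ → ℝ) (x : ℝ → ℝ) (y : ℝ → V) (t : ℝ) : H :=
  S.emb (y t) - Real.exp (σ * w t) • S.expLs lam t (S.emb (y 0))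
    - ∫ s in (0 : ℝ)..t,
        Real.exp (σ * (w t - w s)) • S.expLs lam (t - s) (S.E2 lam (x s) (y s))

end Setting

end Pitchfork

end

namespace Pitchfork

namespace Setting

variable {H V : Type*} [NormedAddCommGroup H] [InnerProductSpace ℝ H] [CompleteSpace H]
  [NormedAddCommGroup V] [NormedSpace ℝ V] [CompleteSpace V] (S : Setting H V)

/-- The operator `L_lam` as a linear map on `D(A)`. -/
def linL (lam : ℝ) : S.A.domain →ₗ[ℝ] H := (perturbedOp S.A S.incl (S.P lam)).toFun

theorem linL_eq_L (lam : ℝ) (u : S.A.domain) : S.linL lam u = S.L lam u := rfl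

theorem linL_apply (lam : ℝ) (u : S.A.domain) :
    S.linL lam u = -S.A u + S.P lam (S.incl u) := rfl

theorem linL_sub (lam mu : ℝ) (u : S.A.domain) :
    S.linL lam u = S.linL mu u + (S.P lam - S.P mu) (S.incl u) := by
  simp only [linL_apply, sub_apply]
  abel

theorem linL_e {lam : ℝ} (hl : lam ∈ S.Lam) (n : ℕ) :
    S.linL lam (S.e lam n) = S.β lam n • (S.e lam n : H) := S.eigen lam hl n

theorem linL_symm {lam : ℝ} (hl : lam ∈ S.Lam) (u v : S.A.domain) :
    ⟪S.linL lam u, (v : H)⟫_ℝ = ⟪(u : H), S.linL lam v⟫_ℝ := by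
  have hsa := S.selfAdjoint lam hl
  have h := LinearPMap.adjoint_isFormalAdjoint hsa.dense_domain
  rw [LinearPMap.isSelfAdjoint_def] at hsa
  rw [hsa] at h
  exact h u v

theorem inner_linL_e {lam : ℝ} (hl : lam ∈ S.Lam) (u : S.A.domain) (n : ℕ) :
    ⟪S.linL lam u, (S.e lam n : H)⟫_ℝ = S.β lam n * ⟪(u : H), (S.e lam n : H)⟫_ℝ := by
  rw [S.linL_symm hl, S.linL_e hl, inner_smul_right]

/-- The eigenmodes as a Hilbert basis. -/
noncomputable def eigenbasis {lam : ℝ} (hl : lam ∈ S.Lam) : HilbertBasis ℕ ℝ H :=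
  HilbertBasis.mk (S.e_orthonormal lam hl)
    ((Submodule.dense_iff_topologicalClosure_eq_top.1 (S.e_complete lam hl)).ge)

theorem eigenbasis_apply {lam : ℝ} (hl : lam ∈ S.Lam) (n : ℕ) :
    S.eigenbasis hl n = (S.e lam n : H) := by
  simp [eigenbasis]

theorem hasSum_inner_e {lam : ℝ} (hl : lam ∈ S.Lam) (x y : H) :
    HasSum (fun n => ⟪x, (S.e lam n : H)⟫_ℝ * ⟪y, (S.e lam n : H)⟫_ℝ) ⟪x, y⟫_ℝ := by
  have h := (S.eigenbasis hl).hasSum_inner_mul_inner x y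
  simp only [eigenbasis_apply] at h
  simpa only [real_inner_comm y] using h

theorem ext_inner_e {lam : ℝ} (hl : lam ∈ S.Lam) {x y : H}
    (h : ∀ n, ⟪x, (S.e lam n : H)⟫_ℝ = ⟪y, (S.e lam n : H)⟫_ℝ) : x = y := by
  refine ext_inner_right ℝ fun v => ?_
  have h1 := S.hasSum_inner_e hl x v
  simp only [h] at h1
  exact h1.unique (S.hasSum_inner_e hl y v)

/-- Variational upper bound of the quadratic form on the complement of the first eigenmodes. -/
theorem inner_linL_self_le {lam : ℝ} (hl : lam ∈ S.Lam) (m : ℕ) (u : S.A.domain)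
    (hu : ∀ k < m, ⟪(u : H), (S.e lam k : H)⟫_ℝ = 0) :
    ⟪S.linL lam u, (u : H)⟫_ℝ ≤ S.β lam m * ‖(u : H)‖ ^ 2 := by
  have h1 := S.hasSum_inner_e hl (S.linL lam u) u
  have h2 := (S.hasSum_inner_e hl (u : H) u).mul_left (S.β lam m)
  rw [real_inner_self_eq_norm_sq] at h2
  refine hasSum_le (fun n => ?_) h1 h2
  rw [S.inner_linL_e hl, mul_assoc]
  rcases lt_or_ge n m with hn | hn
  · simp [hu n hn]
  · exact mul_le_mul_of_nonneg_right (S.β_antitone lam hl hn) (mul_self_nonneg _)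

/-- `D(A)` with the graph norm of `L_lam` embeds continuously into `V`. -/
theorem exists_norm_incl_le {lam : ℝ} (hl : lam ∈ S.Lam) :
    ∃ C, 0 < C ∧ ∀ u : S.A.domain, ‖S.incl u‖ ≤ C * (‖(u : H)‖ + ‖S.linL lam u‖) := by
  set T := perturbedOp S.A S.incl (S.P lam) with hT
  have hclosed : IsClosed (T.graph : Set (H × H)) := (S.selfAdjoint lam hl).isClosed
  have : CompleteSpace T.graph := hclosed.completeSpace_coe
  have hmem : ∀ g : T.graph, (g : H × H).1 ∈ S.A.domain := fun g =>
    LinearPMap.mem_domain_of_mem_graph (f := T) (x := g.1.1) (y := g.1.2) g.2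
  let F : T.graph →ₗ[ℝ] V := S.incl ∘ₗ
    ((LinearMap.fst ℝ H H ∘ₗ T.graph.subtype).codRestrict S.A.domain hmem)
  have hF : ∀ g, S.emb (F g) = (g : H × H).1 := fun g => S.emb_incl _
  have hcont : Continuous F := by
    refine LinearMap.continuous_of_seq_closed_graph _ fun g x y hg hy => S.emb_injective ?_
    rw [hF]
    have h1 := (S.emb.continuous.tendsto y).comp hy
    have h2 := ((continuous_fst.comp continuous_subtype_val).tendsto x).comp hg
    refine tendsto_nhds_unique h1 (h2.congr fun n => ?_)
    simp [hF]
  let Fc : T.graph →L[ℝ] V := ⟨F, hcont⟩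
  refine ⟨‖Fc‖ + 1, by positivity, fun u => ?_⟩
  have hg : ((u : H), S.linL lam u) ∈ T.graph := T.mem_graph u
  have h := Fc.le_opNorm ⟨_, hg⟩
  have hFu : Fc ⟨_, hg⟩ = S.incl u := rfl
  rw [hFu] at h
  refine h.trans ?_
  have hn : ‖(⟨_, hg⟩ : T.graph)‖ ≤ ‖(u : H)‖ + ‖S.linL lam u‖ := by
    rw [Submodule.coe_norm, Prod.norm_def]
    exact max_le (le_add_of_nonneg_right (norm_nonneg _)) (le_add_of_nonneg_left (norm_nonneg _))
  gcongr
  linarith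

theorem Lam_of_Icc {lam : ℝ} (h : lam ∈ Icc S.lamC S.lamStar) : lam ∈ S.Lam := S.Icc_subset h

theorem eventually_norm_P_sub_lt {lam : ℝ} (h : lam ∈ Icc S.lamC S.lamStar) {d : ℝ} (hd : 0 < d) :
    ∀ᶠ mu in 𝓝[Icc S.lamC S.lamStar] lam, ‖S.P mu - S.P lam‖ < d := by
  have hc := (S.P_continuous.mono S.Icc_subset) lam h
  have := (Metric.tendsto_nhds.1 hc) d hd
  simpa only [dist_eq_norm] using this

/-- A local uniform bound on the parameter interval is a global one. -/
theorem exists_bound_of_local (p : ℝ → ℝ → Prop) (hp : ∀ lam, Monotone (p lam))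
    (hloc : ∀ lam ∈ Icc S.lamC S.lamStar, ∃ C : ℝ,
      ∀ᶠ mu in 𝓝[Icc S.lamC S.lamStar] lam, p mu C) :
    ∃ C, 0 < C ∧ ∀ lam ∈ Icc S.lamC S.lamStar, p lam C := by
  refine isCompact_Icc.induction_on (p := fun s => ∃ C, 0 < C ∧ ∀ lam ∈ s, p lam C)
    ⟨1, one_pos, by simp⟩ ?_ ?_ ?_
  · rintro s t hst ⟨C, hC, h⟩
    exact ⟨C, hC, fun l hl => h l (hst hl)⟩
  · rintro s t ⟨C, hC, h⟩ ⟨D, hD, h'⟩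
    refine ⟨max C D, lt_max_of_lt_left hC, ?_⟩
    rintro l (hl | hl)
    · exact hp l (le_max_left _ _) (h l hl)
    · exact hp l (le_max_right _ _) (h' l hl)
  · intro lam hlam
    obtain ⟨C, hC⟩ := hloc lam hlam
    exact ⟨_, hC, max C 1, by positivity, fun l hl => hp l (le_max_left _ _) hl⟩

/-- The embedding of the graph spaces of `L_lam` into `V` is uniform in the parameter. -/
theorem exists_norm_incl_le_uniform :
    ∃ C, 0 < C ∧ ∀ lam ∈ Icc S.lamC S.lamStar, ∀ u : S.A.domain,
      ‖S.incl u‖ ≤ C * (‖(u : H)‖ + ‖S.linL lam u‖) := by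
  refine S.exists_bound_of_local
    (fun lam C => ∀ u : S.A.domain, ‖S.incl u‖ ≤ C * (‖(u : H)‖ + ‖S.linL lam u‖))
    (fun lam a b hab h u => (h u).trans (by gcongr)) fun lam hlam => ?_
  obtain ⟨C, hC, h⟩ := S.exists_norm_incl_le (S.Lam_of_Icc hlam)
  refine ⟨2 * C, ?_⟩
  filter_upwards [S.eventually_norm_P_sub_lt hlam (d := 1 / (2 * C)) (by positivity)] with mu hmu u
  have h1 : ‖S.linL lam u‖ ≤ ‖S.linL mu u‖ + 1 / (2 * C) * ‖S.incl u‖ := by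
    have : S.linL lam u = S.linL mu u - (S.P mu - S.P lam) (S.incl u) := by
      rw [S.linL_sub mu lam]; abel
    rw [this]
    refine (norm_sub_le _ _).trans ?_
    gcongr
    exact ((S.P mu - S.P lam).le_opNorm _).trans (by gcongr)
  have h2 := h u
  have h3 : C * (1 / (2 * C) * ‖S.incl u‖) = ‖S.incl u‖ / 2 := by field_simp
  nlinarith [mul_le_mul_of_nonneg_left h1 hC.le]

/-- Comparison of the eigenvalues at two parameter values. -/
theorem β_le_β_add {lam mu C R : ℝ} (hl : lam ∈ S.Lam) (hm : mu ∈ S.Lam) (hC : 0 ≤ C)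
    (hincl : ∀ u : S.A.domain, ‖S.incl u‖ ≤ C * (‖(u : H)‖ + ‖S.linL mu u‖)) (n : ℕ)
    (hR : ∀ k ≤ n, |S.β mu k| ≤ R) :
    S.β mu n ≤ S.β lam n + ‖S.P mu - S.P lam‖ * (C * (1 + R)) := by
  have hR0 : 0 ≤ R := (abs_nonneg _).trans (hR 0 zero_le)
  let F : (Fin (n + 1) → ℝ) →ₗ[ℝ] (Fin n → ℝ) := LinearMap.pi fun k =>
    ∑ j : Fin (n + 1), ⟪(S.e mu j : H), (S.e lam k : H)⟫_ℝ • LinearMap.proj j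
  obtain ⟨a, ha, ha0⟩ := (Submodule.ne_bot_iff _).1
    (LinearMap.ker_ne_bot_of_finrank_lt (f := F) (by simp))
  have hor := (S.e_orthonormal mu hm).comp (fun j : Fin (n + 1) => (j : ℕ)) Fin.val_injective
  let u : S.A.domain := ∑ j : Fin (n + 1), a j • S.e mu j
  have hu : (u : H) = ∑ j : Fin (n + 1), a j • (S.e mu j : H) := by
    simp [u]
  have hLu : S.linL mu u = ∑ j : Fin (n + 1), (a j * S.β mu j) • (S.e mu j : H) := by
    simp only [u, map_sum, map_smul, S.linL_e hm, smul_smul]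
  have hort : ∀ k < n, ⟪(u : H), (S.e lam k : H)⟫_ℝ = 0 := by
    intro k hk
    have := congrFun (LinearMap.mem_ker.1 ha) ⟨k, hk⟩
    simp only [F, LinearMap.pi_apply, LinearMap.sum_apply, LinearMap.smul_apply,
      LinearMap.proj_apply, smul_eq_mul, Pi.zero_apply] at this
    rw [hu, sum_inner, ← this]
    exact Finset.sum_congr rfl fun j _ => by rw [real_inner_smul_left, mul_comm]
  have hnorm : ‖(u : H)‖ ^ 2 = ∑ j, a j * a j := by
    rw [← real_inner_self_eq_norm_sq, hu]
    simpa using hor.inner_sum a a Finset.univ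
  have hpos : 0 < ‖(u : H)‖ := by
    have : 0 < ‖(u : H)‖ ^ 2 := by
      rw [hnorm]
      obtain ⟨j, hj⟩ := Function.ne_iff.1 ha0
      exact Finset.sum_pos' (fun i _ => mul_self_nonneg _)
        ⟨j, Finset.mem_univ _, mul_self_pos.2 hj⟩
    exact norm_pos_iff.2 fun h => by simp [h] at this
  have hquad : S.β mu n * ‖(u : H)‖ ^ 2 ≤ ⟪S.linL mu u, (u : H)⟫_ℝ := by
    have h1 : ⟪S.linL mu u, (u : H)⟫_ℝ = ∑ j : Fin (n + 1), a j * S.β mu j * a j := by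
      rw [hLu, hu]
      simpa using hor.inner_sum (fun j => a j * S.β mu j) a Finset.univ
    rw [h1, hnorm, Finset.mul_sum]
    refine Finset.sum_le_sum fun j _ => ?_
    have := S.β_antitone mu hm (Nat.lt_succ_iff.1 j.2)
    nlinarith [mul_self_nonneg (a j)]
  have hLnorm : ‖S.linL mu u‖ ≤ R * ‖(u : H)‖ := by
    refine abs_le_of_sq_le_sq' ?_ (by positivity) |>.2
    have h1 : ‖S.linL mu u‖ ^ 2 = ∑ j : Fin (n + 1), a j * S.β mu j * (a j * S.β mu j) := by
      rw [← real_inner_self_eq_norm_sq, hLu]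
      simpa using hor.inner_sum (fun j => a j * S.β mu j) (fun j => a j * S.β mu j) Finset.univ
    rw [h1, mul_pow, hnorm, Finset.mul_sum]
    refine Finset.sum_le_sum fun j _ => ?_
    have h2 : S.β mu j ^ 2 ≤ R ^ 2 := sq_le_sq' (abs_le.1 (hR j (Nat.lt_succ_iff.1 j.2))).1
      (abs_le.1 (hR j (Nat.lt_succ_iff.1 j.2))).2
    nlinarith [mul_self_nonneg (a j)]
  have hV : ‖S.incl u‖ ≤ C * (1 + R) * ‖(u : H)‖ := by
    refine (hincl u).trans ?_
    rw [mul_assoc]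
    gcongr
    linarith
  have hup := S.inner_linL_self_le hl n u hort
  rw [S.linL_sub mu lam, inner_add_left] at hquad
  have hpert : ⟪(S.P mu - S.P lam) (S.incl u), (u : H)⟫_ℝ
      ≤ ‖S.P mu - S.P lam‖ * (C * (1 + R)) * ‖(u : H)‖ ^ 2 := by
    refine (real_inner_le_norm _ _).trans ?_
    calc _ ≤ ‖S.P mu - S.P lam‖ * (C * (1 + R) * ‖(u : H)‖) * ‖(u : H)‖ := by
          gcongr
          exact ((S.P mu - S.P lam).le_opNorm _).trans (by gcongr)
      _ = _ := by ring
  have hsq : 0 < ‖(u : H)‖ ^ 2 := by positivity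
  refine le_of_mul_le_mul_right ?_ hsq
  linarith

theorem eps_nonneg {lam : ℝ} (h : lam ∈ Icc S.lamC S.lamStar) : 0 ≤ S.eps lam := by
  rcases h.1.eq_or_lt with h1 | h1
  · rw [eps, ← h1, S.critical_zero]
  · exact (S.critical_pos lam (S.Lam_of_Icc h) h1).le

theorem one_lt_N : 1 < S.N := by
  obtain ⟨n, h1, h2, _⟩ := S.interaction_ne S.lamC ⟨le_rfl, S.lamC_lt.le⟩
  omega

theorem norm_e {lam : ℝ} (h : lam ∈ S.Lam) (n : ℕ) : ‖(S.e lam n : H)‖ = 1 :=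
  (S.e_orthonormal lam h).1 n

theorem exists_eps_le : ∃ E, 0 < E ∧ ∀ lam ∈ Icc S.lamC S.lamStar, S.eps lam ≤ E := by
  obtain ⟨C, hC, hincl⟩ := S.exists_norm_incl_le_uniform
  refine S.exists_bound_of_local (fun lam E => S.eps lam ≤ E) (fun lam a b hab h => h.trans hab)
    fun lam hlam => ⟨2 * S.eps lam + 1, ?_⟩
  filter_upwards [S.eventually_norm_P_sub_lt hlam (d := 1 / (2 * C)) (by positivity),
    self_mem_nhdsWithin] with mu hmu hmI
  have h0 := S.eps_nonneg hmI
  have h := S.β_le_β_add (S.Lam_of_Icc hlam) (S.Lam_of_Icc hmI) hC.le (hincl mu hmI) 0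
    (R := S.eps mu) (fun k hk => by
      obtain rfl := Nat.le_zero.1 hk
      exact (abs_of_nonneg h0).le)
  have h1 : ‖S.P mu - S.P lam‖ * (C * (1 + S.eps mu)) ≤ 1 / (2 * C) * (C * (1 + S.eps mu)) := by
    gcongr
  have h2 : 1 / (2 * C) * (C * (1 + S.eps mu)) = (1 + S.eps mu) / 2 := by field_simp
  simp only [eps] at *
  linarith

theorem exists_abs_β_le (n : ℕ) : ∃ R, 0 < R ∧ ∀ lam ∈ Icc S.lamC S.lamStar,
    ∀ k ≤ n, |S.β lam k| ≤ R := by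
  obtain ⟨C, hC, hincl⟩ := S.exists_norm_incl_le_uniform
  obtain ⟨E, hE, hE'⟩ := S.exists_eps_le
  obtain ⟨R, hR, hR'⟩ : ∃ R, 0 < R ∧ ∀ lam ∈ Icc S.lamC S.lamStar, -S.β lam n ≤ R := by
    refine S.exists_bound_of_local (fun lam R => -S.β lam n ≤ R) (fun lam a b hab h => h.trans hab)
      fun lam hlam => ?_
    obtain ⟨R, hR⟩ : ∃ R, ∀ k ≤ n, |S.β lam k| ≤ R :=
      ⟨∑ k ∈ Finset.range (n + 1), |S.β lam k|, fun k hk =>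
        Finset.single_le_sum (f := fun k => |S.β lam k|) (fun _ _ => abs_nonneg _)
          (Finset.mem_range.2 (by omega))⟩
    have hR0 : 0 ≤ R := (abs_nonneg _).trans (hR 0 zero_le)
    refine ⟨-S.β lam n + C * (1 + R), ?_⟩
    filter_upwards [S.eventually_norm_P_sub_lt hlam one_pos, self_mem_nhdsWithin] with mu hmu hmI
    have h := S.β_le_β_add (S.Lam_of_Icc hmI) (S.Lam_of_Icc hlam) hC.le (hincl lam hlam) n hR
    rw [norm_sub_rev] at h
    have h1 : ‖S.P mu - S.P lam‖ * (C * (1 + R)) ≤ 1 * (C * (1 + R)) := by gcongr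
    linarith
  refine ⟨E + R, by positivity, fun lam hlam k hk => abs_le.2 ⟨?_, ?_⟩⟩
  · linarith [hR' lam hlam, S.β_antitone lam (S.Lam_of_Icc hlam) hk]
  · have := S.β_antitone lam (S.Lam_of_Icc hlam) (Nat.zero_le k)
    have h2 := hE' lam hlam
    simp only [eps] at h2
    linarith

/-- The stable eigenvalues are bounded away from `0`, uniformly in the parameter. -/
theorem exists_spectral_gap : ∃ g, 0 < g ∧ ∀ lam ∈ Icc S.lamC S.lamStar, ∀ n, 1 ≤ n →
    S.β lam n ≤ -g := by
  obtain ⟨C, hC, hincl⟩ := S.exists_norm_incl_le_uniform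
  obtain ⟨R, hR, hR'⟩ := S.exists_abs_β_le 1
  obtain ⟨D, hD, hD'⟩ : ∃ D, 0 < D ∧ ∀ lam ∈ Icc S.lamC S.lamStar, 0 < D ∧ S.β lam 1 ≤ -(1 / D) := by
    refine S.exists_bound_of_local (fun lam D => 0 < D ∧ S.β lam 1 ≤ -(1 / D))
      (fun lam a b hab h => ⟨h.1.trans_le hab, h.2.trans ?_⟩) fun lam hlam => ?_
    · exact neg_le_neg (one_div_le_one_div_of_le h.1 hab)
    · have hneg := S.stable_neg lam hlam 1 le_rfl
      refine ⟨2 / (-S.β lam 1), ?_⟩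
      filter_upwards [S.eventually_norm_P_sub_lt hlam (d := -S.β lam 1 / (2 * (C * (1 + R))))
        (div_pos (by linarith) (by positivity)), self_mem_nhdsWithin] with mu hmu hmI
      refine ⟨div_pos two_pos (by linarith), ?_⟩
      have h := S.β_le_β_add (S.Lam_of_Icc hlam) (S.Lam_of_Icc hmI) hC.le (hincl mu hmI) 1
        (hR' mu hmI)
      have h1 : ‖S.P mu - S.P lam‖ * (C * (1 + R))
          ≤ -S.β lam 1 / (2 * (C * (1 + R))) * (C * (1 + R)) := by gcongr
      have h2 : -S.β lam 1 / (2 * (C * (1 + R))) * (C * (1 + R)) = -S.β lam 1 / 2 := by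
        field_simp
      rw [one_div_div]
      linarith
  exact ⟨1 / D, by positivity, fun lam hlam n hn =>
    (S.β_antitone lam (S.Lam_of_Icc hlam) hn).trans (hD' lam hlam).2⟩

/-- The interacting eigenmodes are bounded in `V`, uniformly in the parameter. -/
theorem exists_norm_eV_le : ∃ C, 0 < C ∧ ∀ lam ∈ Icc S.lamC S.lamStar, ∀ n < S.N,
    ‖S.eV lam n‖ ≤ C := by
  obtain ⟨C, hC, hincl⟩ := S.exists_norm_incl_le_uniform
  obtain ⟨R, hR, hR'⟩ := S.exists_abs_β_le S.N
  refine ⟨C * (1 + R), by positivity, fun lam hlam n hn => (hincl lam hlam _).trans ?_⟩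
  rw [S.linL_e (S.Lam_of_Icc hlam), norm_smul, S.norm_e (S.Lam_of_Icc hlam), mul_one]
  gcongr
  exact hR' lam hlam n hn.le

end Setting

end Pitchfork

namespace Pitchfork

variable {Ω : Type*} [MeasurableSpace Ω] {Pr : Measure Ω}

theorem isProbabilityMeasure_of_isPreBrownianReal {B : ℝ≥0 → Ω → ℝ}
    (hB : IsPreBrownianReal B Pr) : IsProbabilityMeasure Pr :=
  hB.isGaussianProcess.isProbabilityMeasure

theorem integral_abs_brownian_le {B : ℝ≥0 → Ω → ℝ} (hB : IsPreBrownianReal B Pr) (t : ℝ≥0) :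
    ∫ ω, |B t ω| ∂Pr ≤ Real.sqrt t := by
  have := isProbabilityMeasure_of_isPreBrownianReal hB
  have hL2 : MemLp (B t) 2 Pr := (hB.isGaussianProcess.hasGaussianLaw_eval t).memLp_two
  have hvar : ∫ ω, B t ω ^ 2 ∂Pr = t := by
    rw [← variance_of_integral_eq_zero (hB.aemeasurable t) (hB.integral_eval t),
      ← covariance_self (hB.aemeasurable t), hB.covariance_eval, min_self]
  have h1 : ∀ r : ℝ, 0 < r → ∫ ω, |B t ω| ∂Pr ≤ (t / r + r) / 2 := by
    intro r hr
    have h2 : ∫ ω, |B t ω| ∂Pr ≤ ∫ ω, (B t ω ^ 2 / r + r) / 2 ∂Pr := by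
      refine integral_mono (hB.integrable_eval t).abs
        (((hL2.integrable_sq.div_const r).add (integrable_const r)).div_const 2) fun ω => ?_
      have h4 : B t ω ^ 2 / r + r - 2 * |B t ω| = (|B t ω| - r) ^ 2 / r := by
        rw [← sq_abs]; field_simp; ring
      have : 0 ≤ (|B t ω| - r) ^ 2 / r := by positivity
      dsimp only
      linarith
    rwa [integral_div, integral_add (hL2.integrable_sq.div_const r) (integrable_const r),
      integral_div, hvar, integral_const, probReal_univ, one_smul] at h2
  rcases eq_or_ne t 0 with rfl | ht
  · refine le_of_forall_pos_le_add fun r hr => ?_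
    have := h1 (2 * r) (by positivity)
    simp at this ⊢
    linarith
  · have ht' : 0 < Real.sqrt t := Real.sqrt_pos.2 (by positivity)
    have := h1 _ ht'
    rwa [Real.div_sqrt, add_self_div_two] at this

/-- Doob's maximal inequality for a Brownian motion sampled along an increasing sequence. -/
theorem measure_exists_le_abs_brownian_le {B : ℝ≥0 → Ω → ℝ} (hB : IsPreBrownianReal B Pr)
    (hm : ∀ t, Measurable (B t)) {t : ℕ → ℝ≥0} (ht : Monotone t) (n : ℕ) {a : ℝ} (ha : 0 < a) :
    Pr {ω | ∃ k ≤ n, a ≤ |B (t k) ω|} ≤ ENNReal.ofReal (Real.sqrt (t n) / a) := by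
  have := isProbabilityMeasure_of_isPreBrownianReal hB
  have hsm : ∀ k, StronglyMeasurable (B (t k)) := fun k => (hm (t k)).stronglyMeasurable
  let ℱ : Filtration ℕ (inferInstance : MeasurableSpace Ω) :=
    Filtration.natural (fun k => B (t k)) hsm
  have hadp : StronglyAdapted ℱ (fun k => B (t k)) := Filtration.stronglyAdapted_natural hsm
  have hmart : Martingale (fun k => B (t k)) ℱ Pr := by
    refine martingale_nat hadp (fun k => hB.integrable_eval _) fun i => ?_
    have hsum : B (t (i + 1)) = B (t i) + (B (t (i + 1)) - B (t i)) := by abel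
    have hind : IndepFun (B (t (i + 1)) - B (t i)) (fun ω (s : Set.Iic (t i)) => B s ω) Pr := by
      have h := (hB.indepFun_shift (t i)).comp
        (measurable_pi_apply (t (i + 1) - t i)) measurable_id
      convert h using 1
      swap; · rfl
      ext ω
      simp [add_tsub_cancel_of_le (ht (Nat.le_succ i))]
    have hle : (ℱ i : MeasurableSpace Ω) ≤
        MeasurableSpace.comap (fun ω (s : Set.Iic (t i)) => B s ω) inferInstance := by
      refine iSup₂_le fun j hj => ?_
      rintro _ ⟨s, hs, rfl⟩
      exact ⟨(fun x => x ⟨t j, ht hj⟩) ⁻¹' s, measurable_pi_apply _ hs, rfl⟩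
    have hD : Measurable (B (t (i + 1)) - B (t i)) := (hm _).sub (hm _)
    have h1 := condExp_indep_eq (μ := Pr) (f := B (t (i + 1)) - B (t i))
      (m₁ := MeasurableSpace.comap (B (t (i + 1)) - B (t i)) inferInstance) (m₂ := ℱ i)
      hD.comap_le (ℱ.le i)
      (comap_measurable (B (t (i + 1)) - B (t i))).stronglyMeasurable
      (indep_of_indep_of_le_right ((IndepFun_iff_Indep _ _ _).1 hind) hle)
    have h2 : Pr[B (t i) | ℱ i] = B (t i) :=
      condExp_of_stronglyMeasurable (ℱ.le i) (hadp i) (hB.integrable_eval _)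
    have h3 := condExp_add (hB.integrable_eval (t i))
      ((hB.integrable_eval (t (i + 1))).sub (hB.integrable_eval (t i))) (ℱ i)
    have h4 : ∫ ω, (B (t (i + 1)) - B (t i)) ω ∂Pr = 0 := by
      simp only [Pi.sub_apply]
      rw [integral_sub (hB.integrable_eval _) (hB.integrable_eval _), hB.integral_eval,
        hB.integral_eval, sub_zero]
    rw [← hsum] at h3
    filter_upwards [h1, h3] with ω h1 h3
    rw [h3, Pi.add_apply, h1, h2, h4, add_zero]
  have hsub : Submartingale (fun k ω => |B (t k) ω|) ℱ Pr :=
    hmart.submartingale.sup hmart.neg.submartingale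
  have hmax := maximal_ineq hsub (fun _ _ => abs_nonneg _) (ε := a.toNNReal) n
  have hset : {ω | ∃ k ≤ n, a ≤ |B (t k) ω|} = {ω | (a.toNNReal : ℝ) ≤
      (Finset.range (n + 1)).sup' Finset.nonempty_range_add_one fun k => |B (t k) ω|} := by
    ext ω
    simp [Finset.le_sup'_iff, Real.coe_toNNReal a ha.le]
  rw [← hset] at hmax
  have hint : ∫ ω in {ω | ∃ k ≤ n, a ≤ |B (t k) ω|}, |B (t n) ω| ∂Pr ≤ Real.sqrt (t n) :=
    (setIntegral_le_integral (hB.integrable_eval _).abs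
      (Eventually.of_forall fun _ => abs_nonneg _)).trans (integral_abs_brownian_le hB _)
  have hmax₂ := hmax.trans (ENNReal.ofReal_le_ofReal hint)
  rw [ENNReal.ofReal_div_of_pos ha, ENNReal.le_div_iff_mul_le (by simp [ha]) (by simp), mul_comm]
  exact hmax₂

/-- Maximal inequality for Brownian motion. -/
theorem measure_exists_lt_abs_brownian_le {B : ℝ≥0 → Ω → ℝ} (hB : IsBrownianReal B Pr)
    {S : ℝ≥0} (hS : 0 < S) {a : ℝ} (ha : 0 < a) :
    Pr {ω | ∃ s ≤ S, a < |B s ω|} ≤ ENNReal.ofReal (Real.sqrt S / a) := by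
  let B' : ℝ≥0 → Ω → ℝ := fun t => (hB.aemeasurable t).mk (B t)
  have hB' : IsPreBrownianReal B' Pr :=
    hB.toIsPreBrownianReal.congr fun t => (hB.aemeasurable t).ae_eq_mk
  have hm : ∀ t, Measurable (B' t) := fun t => (hB.aemeasurable t).measurable_mk
  let grid : ℕ → ℕ → ℝ≥0 := fun n k => k / 2 ^ n * S
  have hgrid : ∀ n, Monotone (grid n) := fun n i j hij => by
    dsimp only [grid]; gcongr
  let U : ℕ → Set Ω := fun n => {ω | ∃ k ≤ 2 ^ n, a ≤ |B' (grid n k) ω|}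
  have hU : Monotone U := by
    refine monotone_nat_of_le_succ fun n ω => ?_
    rintro ⟨k, hk, h⟩
    refine ⟨2 * k, by rw [pow_succ]; omega, ?_⟩
    have : grid (n + 1) (2 * k) = grid n k := by
      simp only [grid, pow_succ]
      push_cast
      field_simp
    rwa [this]
  have hUle : Pr (⋃ n, U n) ≤ ENNReal.ofReal (Real.sqrt S / a) := by
    rw [hU.measure_iUnion]
    refine iSup_le fun n => (measure_exists_le_abs_brownian_le hB' hm (hgrid n) (2 ^ n) ha).trans ?_
    simp [grid]
  refine (measure_mono_ae ?_).trans hUle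
  have hae : ∀ᵐ ω ∂Pr, ∀ n k : ℕ, B (grid n k) ω = B' (grid n k) ω :=
    ae_all_iff.2 fun n => ae_all_iff.2 fun k => (hB.aemeasurable _).ae_eq_mk
  filter_upwards [hB.cont, hae] with ω hc hω
  rintro ⟨s, hs, h⟩
  have hlim : Tendsto (fun n : ℕ => grid n ⌊s / S * 2 ^ n⌋₊) atTop (𝓝 s) := by
    have h1 : Tendsto (fun n : ℕ => (2 : ℝ≥0) ^ n) atTop atTop :=
      tendsto_pow_atTop_atTop_of_one_lt one_lt_two
    have h2 := ((tendsto_nat_floor_mul_div_atTop (R := ℝ) (a := ((s / S : ℝ≥0) : ℝ))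
      (by positivity)).comp (tendsto_pow_atTop_atTop_of_one_lt (one_lt_two (α := ℝ)))).mul_const
        (S : ℝ)
    rw [← NNReal.tendsto_coe]
    convert h2 using 2
    · simp only [grid, Function.comp]
      push_cast
      congr 3
    · push_cast
      field_simp
  have hev := ((hc.tendsto s).comp hlim).abs.eventually (lt_mem_nhds h)
  obtain ⟨n, hn⟩ := hev.exists
  refine mem_iUnion.2 ⟨n, ⌊s / S * 2 ^ n⌋₊, ?_, ?_⟩
  · refine Nat.floor_le_of_le ?_
    push_cast
    exact mul_le_of_le_one_left (by positivity) ((div_le_one hS).2 hs)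
  · rw [← hω]
    exact hn.le

/-- Brownian motion grows sublinearly, uniformly under Brownian scaling. -/
theorem exists_measure_growth_le {B : ℝ≥0 → Ω → ℝ} (hB : IsBrownianReal B Pr) {d : ℝ} (hd : 0 < d) :
    ∃ K, 0 < K ∧ ∀ ε, 0 < ε →
      Pr {ω | ∃ s : ℝ≥0, K + ε * s < Real.sqrt ε * |B s ω|} ≤ ENNReal.ofReal d := by
  obtain ⟨k₀, hk₀⟩ := exists_pow_lt_of_lt_one (show 0 < d / 8 by positivity)
    (show (1 / 2 : ℝ) < 1 by norm_num)
  refine ⟨2 ^ k₀ * (2 / d), by positivity, fun ε hε => ?_⟩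
  set K : ℝ := 2 ^ k₀ * (2 / d) with hK
  have hKpos : 0 < K := by positivity
  set e : ℝ≥0 := ⟨ε, hε.le⟩ with he
  have hec : (e : ℝ) = ε := rfl
  have hepos : 0 < e := hε
  have hsq : 0 < Real.sqrt ε := Real.sqrt_pos.2 hε
  have hs4 : ∀ k : ℕ, Real.sqrt (((4 ^ k / e : ℝ≥0) : ℝ)) = 2 ^ k / Real.sqrt ε := by
    intro k
    push_cast
    rw [hec, Real.sqrt_div (by positivity), show (4 : ℝ) ^ k = (2 ^ k) ^ 2 by
      rw [← pow_mul, mul_comm, pow_mul]; norm_num, Real.sqrt_sq (by positivity)]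
  let U : ℕ → Set Ω := fun j =>
    {ω | ∃ s ≤ (4 ^ (k₀ + j + 1) / e : ℝ≥0), 4 ^ (k₀ + j) / Real.sqrt ε < |B s ω|}
  let U₀ : Set Ω := {ω | ∃ s ≤ (4 ^ k₀ / e : ℝ≥0), K / Real.sqrt ε < |B s ω|}
  have hcover : {ω | ∃ s : ℝ≥0, K + ε * s < Real.sqrt ε * |B s ω|} ⊆ U₀ ∪ ⋃ j, U j := by
    rintro ω ⟨s, hs⟩
    rcases le_or_gt s (4 ^ k₀ / e) with h | h
    · refine Or.inl ⟨s, h, ?_⟩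
      rw [div_lt_iff₀ hsq, mul_comm]
      have : 0 ≤ ε * s := by positivity
      linarith
    · have h1 : 1 ≤ e * s / 4 ^ k₀ := by
        rw [div_lt_iff₀ hepos] at h
        rw [le_div_iff₀ (by positivity), one_mul, mul_comm]
        exact h.le
      obtain ⟨j, hj1, hj2⟩ := exists_nat_pow_near h1 (show (1 : ℝ≥0) < 4 by norm_num)
      refine Or.inr (mem_iUnion.2 ⟨j, s, ?_, ?_⟩)
      · rw [div_lt_iff₀ (by positivity)] at hj2
        rw [le_div_iff₀ hepos, mul_comm]
        exact hj2.le.trans_eq (by ring)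
      · rw [le_div_iff₀ (by positivity)] at hj1
        rw [div_lt_iff₀ hsq, mul_comm]
        have h2 : (4 : ℝ) ^ j * 4 ^ k₀ ≤ ε * s := by exact_mod_cast hj1
        rw [pow_add, mul_comm]
        linarith
  have hU₀ : Pr U₀ ≤ ENNReal.ofReal (d / 2) := by
    refine (measure_exists_lt_abs_brownian_le hB (by positivity) (by positivity)).trans
      (ENNReal.ofReal_le_ofReal (le_of_eq ?_))
    rw [hs4, hK]
    field_simp
  have hUj : ∀ j, Pr (U j) ≤ ENNReal.ofReal (d / 4 * (1 / 2) ^ j) := by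
    intro j
    refine (measure_exists_lt_abs_brownian_le hB (by positivity) (by positivity)).trans
      (ENNReal.ofReal_le_ofReal ?_)
    rw [hs4, div_div_div_cancel_right₀ hsq.ne']
    have h4 : (4 : ℝ) ^ (k₀ + j) = 2 ^ (k₀ + j) * 2 ^ (k₀ + j) := by
      rw [← mul_pow]; norm_num
    have : (2 : ℝ) ^ (k₀ + j + 1) / 4 ^ (k₀ + j) = 2 * (1 / 2) ^ k₀ * (1 / 2) ^ j := by
      rw [h4, pow_succ, mul_div_mul_left _ _ (by positivity), mul_assoc, ← pow_add, div_pow,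
        one_pow, mul_one_div]
    rw [this]
    gcongr
    linarith
  calc Pr {ω | ∃ s : ℝ≥0, K + ε * s < Real.sqrt ε * |B s ω|}
      ≤ Pr U₀ + ∑' j, Pr (U j) := (measure_mono hcover).trans
        ((measure_union_le _ _).trans (by gcongr; exact measure_iUnion_le _))
    _ ≤ ENNReal.ofReal (d / 2) + ∑' j : ℕ, ENNReal.ofReal (d / 4 * (1 / 2) ^ j) := by
        gcongr with j
        exact hUj j
    _ = ENNReal.ofReal (d / 2) + ENNReal.ofReal (d / 2) := by
        rw [← ENNReal.ofReal_tsum_of_nonneg (fun j => by positivity)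
          (summable_geometric_two.mul_left _), tsum_mul_left, tsum_geometric_two]
        ring_nf
    _ = ENNReal.ofReal d := by
        rw [← ENNReal.ofReal_add (by positivity) (by positivity), add_halves]

/-- The properties of the noise paths used below: continuity, and growth of `σ w`. -/
structure GoodPath (ε K : ℝ) (w : ℝ → ℝ) : Prop where
  continuous : Continuous w
  zero : w 0 = 0
  growth : ∀ t, |Real.sqrt ε * w t| ≤ K + ε * |t|

theorem exists_measure_not_goodPath_le {W : ℝ → Ω → ℝ} (hW : IsTwoSidedBrownian W Pr)
    {d : ℝ} (hd : 0 < d) :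
    ∃ K, 0 < K ∧ ∀ ε, 0 < ε → Pr {ω | ¬ GoodPath ε K (W · ω)} ≤ ENNReal.ofReal d := by
  obtain ⟨K₁, hK₁, h₁⟩ := exists_measure_growth_le hW.forward (half_pos hd)
  obtain ⟨K₂, hK₂, h₂⟩ := exists_measure_growth_le hW.backward (half_pos hd)
  refine ⟨max K₁ K₂, lt_max_of_lt_left hK₁, fun ε hε => ?_⟩
  have hsq : 0 ≤ Real.sqrt ε := Real.sqrt_nonneg ε
  refine (measure_mono_ae ?_).trans ((measure_union_le _ _).trans
    ((add_le_add (h₁ ε hε) (h₂ ε hε)).trans_eq ?_))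
  · filter_upwards [hW.forward.cont, hW.backward.cont, hW.forward.eval_zero_ae_eq_zero]
      with ω hf hb h0 hbad
    by_contra hcon
    replace hcon : ¬ ((∃ s : ℝ≥0, K₁ + ε * s < Real.sqrt ε * |W s ω|) ∨
      ∃ s : ℝ≥0, K₂ + ε * s < Real.sqrt ε * |W (-(s : ℝ)) ω|) := hcon
    simp only [not_or, not_exists, not_lt] at hcon
    refine hbad ⟨?_, by simpa using h0, fun t => ?_⟩
    · have hf' : ContinuousOn (fun t => W t ω) (Ici 0) := by
        have : Continuous fun t : ℝ => W (t.toNNReal : ℝ) ω := hf.comp continuous_real_toNNReal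
        refine this.continuousOn.congr fun t ht => ?_
        simp [Real.coe_toNNReal t ht]
      have hb' : ContinuousOn (fun t => W t ω) (Iic 0) := by
        have : Continuous fun t : ℝ => W (-((-t).toNNReal : ℝ)) ω :=
          hb.comp (continuous_real_toNNReal.comp continuous_neg)
        refine this.continuousOn.congr fun t ht => ?_
        simp [Real.coe_toNNReal (-t) (by simpa using ht)]
      rw [← continuousOn_univ, ← Iic_union_Ici (a := (0 : ℝ))]
      exact hb'.union_of_isClosed hf' isClosed_Iic isClosed_Ici
    · rw [abs_mul, abs_of_nonneg hsq]
      rcases le_total 0 t with ht | ht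
      · have := hcon.1 t.toNNReal
        rw [Real.coe_toNNReal t ht] at this
        rw [abs_of_nonneg ht]
        exact this.trans (by simp)
      · have := hcon.2 (-t).toNNReal
        rw [Real.coe_toNNReal (-t) (by linarith), neg_neg] at this
        rw [abs_of_nonpos ht]
        exact this.trans (by simp)
  · rw [← ENNReal.ofReal_add (by positivity) (by positivity), add_halves]

end Pitchfork

namespace Pitchfork

/-- A solution of a scalar linear homogeneous equation which starts from `0` vanishes. -/
theorem eqOn_zero_of_hasDerivAt_mul {d g : ℝ → ℝ} (hd : ContinuousOn d (Ici 0))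
    (hg : ContinuousOn g (Ici 0)) (h0 : d 0 = 0)
    (h : ∀ t, 0 < t → HasDerivAt d (g t * d t) t) {t : ℝ} (ht : 0 ≤ t) : d t = 0 := by
  have hg' : Continuous fun r => g (max r 0) :=
    hg.comp_continuous (continuous_id.max continuous_const) fun r =>
      mem_Ici.2 (le_max_right _ _)
  let G : ℝ → ℝ := fun r => ∫ s in (0 : ℝ)..r, g (max s 0)
  have hG : ∀ r, HasDerivAt G (g (max r 0)) r := fun r =>
    intervalIntegral.integral_hasDerivAt_right (hg'.intervalIntegrable _ _)
      (hg'.stronglyMeasurableAtFilter _ _) hg'.continuousAt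
  have hGc : Continuous G := continuous_iff_continuousAt.2 fun r => (hG r).continuousAt
  have h1 := intervalIntegral.integral_eq_sub_of_hasDerivAt_of_le (f := fun r => Real.exp (-G r) * d r)
    (f' := fun _ => 0) ht
    ((Real.continuous_exp.comp hGc.neg).continuousOn.mul (hd.mono fun r hr => hr.1)) (fun r hr => by
      convert! ((hG r).neg.exp.mul (h r hr.1)) using 1
      rw [max_eq_left hr.1.le]
      ring) (by simp)
  simp only [intervalIntegral.integral_zero, h0, mul_zero, sub_zero] at h1
  exact (mul_eq_zero.1 h1.symm).resolve_left (Real.exp_ne_zero _)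

/-- The variation of constants formula for a scalar equation. -/
theorem variation_of_constants {u h : ℝ → ℝ} {b : ℝ} (hu : ContinuousOn u (Ici 0))
    (hh : ContinuousOn h (Ici 0))
    (hder : ∀ t, 0 < t → HasDerivAt u (b * u t + h t) t) {t : ℝ} (ht : 0 ≤ t) :
    u t - Real.exp (b * t) * u 0 = ∫ s in (0 : ℝ)..t, Real.exp (b * (t - s)) * h s := by
  have hc : ContinuousOn (fun s => Real.exp (b * (t - s)) * h s) (Icc 0 t) :=
    ContinuousOn.mul (by fun_prop) (hh.mono fun r hr => hr.1)
  have h1 := intervalIntegral.integral_eq_sub_of_hasDerivAt_of_le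
    (f := fun s => Real.exp (b * (t - s)) * u s)
    (f' := fun s => Real.exp (b * (t - s)) * h s) ht
    (ContinuousOn.mul (by fun_prop) (hu.mono fun r hr => hr.1)) (fun r hr => by
      have h2 : HasDerivAt (fun s => b * (t - s)) (-b) r := by
        convert! ((hasDerivAt_id r).const_sub t).const_mul b using 1
        ring
      convert! h2.exp.mul (hder r hr.1) using 1
      ring) (hc.intervalIntegrable_of_Icc ht)
  rw [h1]
  simp

/-- A nonpositive feedback only damps a scalar linear equation. -/
theorem abs_le_of_hasDerivAt_nonpos {p f : ℝ → ℝ} {e : ℝ} (hp : ContinuousOn p (Ici 0))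
    (hder : ∀ t, 0 < t → HasDerivAt p (e * p t + f t * p t) t) (hf : ∀ t, 0 < t → f t ≤ 0)
    {t : ℝ} (ht : 0 ≤ t) : |p t| ≤ Real.exp (e * t) * |p 0| := by
  let r : ℝ → ℝ := fun s => (Real.exp (-(e * s)) * p s) ^ 2
  have hr : ∀ s, 0 < s → HasDerivAt r (2 * f s * r s) s := by
    intro s hs
    have h2 : HasDerivAt (fun s => -(e * s)) (-e) s := by
      convert! ((hasDerivAt_id s).const_mul e).neg using 1
      rw [mul_one]
    convert! (h2.exp.mul (hder s hs)).pow 2 using 1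
    simp only [r, Pi.mul_apply]
    push_cast
    ring
  have hanti : AntitoneOn r (Ici 0) := by
    refine antitoneOn_of_deriv_nonpos (convex_Ici 0)
      ((ContinuousOn.mul (by fun_prop) hp).pow 2) ?_ ?_
    · intro s hs
      rw [interior_Ici] at hs
      exact (hr s hs).differentiableAt.differentiableWithinAt
    · intro s hs
      rw [interior_Ici] at hs
      rw [(hr s hs).deriv]
      have := hf s hs
      have : 0 ≤ r s := sq_nonneg _
      nlinarith
  have h1 := hanti (mem_Ici.2 le_rfl) (mem_Ici.2 ht) ht
  simp only [r, mul_zero, neg_zero, Real.exp_zero, one_mul] at h1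
  have h2 := sq_le_sq.1 h1
  rw [abs_mul, Real.abs_exp, Real.exp_neg, inv_mul_le_iff₀ (Real.exp_pos _)] at h2
  exact h2

theorem integral_Iic_comp_add (g : ℝ → ℝ) (t : ℝ) :
    ∫ s in Iic (0 : ℝ), g (t + s) = ∫ r in Iic t, g r := by
  have h := (measurePreserving_add_left volume t).setIntegral_preimage_emb
    (measurableEmbedding_addLeft t) g (Iic t)
  rw [← h]
  congr 2
  ext s
  simp

theorem integrableOn_Iic_of_continuous {g : ℝ → ℝ} (hg : Continuous g)
    (h0 : IntegrableOn g (Iic 0)) (t : ℝ) : IntegrableOn g (Iic t) := by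
  refine (h0.union (hg.integrableOn_Icc (a := 0) (b := t))).mono_set fun r hr => ?_
  rcases le_total r 0 with h | h
  · exact Or.inl h
  · exact Or.inr ⟨h, hr⟩

theorem hasDerivAt_integral_Iic {g : ℝ → ℝ} (hg : Continuous g)
    (h0 : IntegrableOn g (Iic 0)) (t : ℝ) : HasDerivAt (fun t => ∫ r in Iic t, g r) (g t) t := by
  have h1 : (fun t => ∫ r in Iic t, g r) = fun t => (∫ r in Iic 0, g r) + ∫ r in (0 : ℝ)..t, g r := by
    ext s
    rw [← intervalIntegral.integral_Iic_sub_Iic h0 (integrableOn_Iic_of_continuous hg h0 s)]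
    ring
  rw [h1]
  exact (intervalIntegral.integral_hasDerivAt_right (hg.intervalIntegrable _ _)
      (hg.stronglyMeasurableAtFilter _ _) hg.continuousAt).const_add _

namespace GoodPath

variable {ε K : ℝ} {w : ℝ → ℝ}

theorem sigma_le (hw : GoodPath ε K w) {t : ℝ} (ht : 0 ≤ t) :
    |Real.sqrt ε * w t| ≤ K + ε * t := by
  simpa [abs_of_nonneg ht] using hw.growth t

theorem integrableOn_exp (hw : GoodPath ε K w) {a : ℝ} (ha : ε < a) :
    IntegrableOn (fun s => Real.exp (a * s + Real.sqrt ε * w s)) (Iic 0) := by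
  have hc := hw.continuous
  refine ((integrableOn_exp_mul_Iic (sub_pos.2 ha) 0).const_mul (Real.exp K)).mono'
    (Continuous.aestronglyMeasurable (by fun_prop)) ?_
  refine (ae_restrict_iff' measurableSet_Iic).2 (Eventually.of_forall fun s hs => ?_)
  rw [Real.norm_eq_abs, Real.abs_exp, ← Real.exp_add, Real.exp_le_exp]
  have := (le_abs_self _).trans (hw.growth s)
  rw [abs_of_nonpos hs] at this
  linarith

theorem integrableOn_exp_mul (hw : GoodPath ε K w) (hε : 0 ≤ ε) :
    IntegrableOn (fun s => Real.exp s * (Real.sqrt ε * w s)) (Iic 0) := by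
  have hc := hw.continuous
  refine ((integrableOn_exp_mul_Iic (show (0 : ℝ) < 1 / 2 by norm_num) 0).const_mul
    (|K| + 2 * ε)).mono' (Continuous.aestronglyMeasurable (by fun_prop)) ?_
  refine (ae_restrict_iff' measurableSet_Iic).2 (Eventually.of_forall fun s (hs : s ≤ 0) => ?_)
  rw [norm_mul, Real.norm_eq_abs, Real.abs_exp, Real.norm_eq_abs]
  have h1 := hw.growth s
  rw [abs_of_nonpos hs] at h1
  have h2 : -s / 2 ≤ Real.exp (-s / 2) := by linarith [Real.add_one_le_exp (-s / 2)]
  have h3 : 1 ≤ Real.exp (-s / 2) := Real.one_le_exp (by linarith)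
  have h4 : Real.exp s = Real.exp (1 / 2 * s) * Real.exp (1 / 2 * s) := by
    rw [← Real.exp_add]; ring_nf
  have h5 : Real.exp (1 / 2 * s) * Real.exp (-s / 2) = 1 := by
    rw [← Real.exp_add]; ring_nf; simp
  have h6 : |Real.sqrt ε * w s| ≤ (|K| + 2 * ε) * Real.exp (-s / 2) := by
    have h7 : |K| ≤ |K| * Real.exp (-s / 2) := le_mul_of_one_le_right (abs_nonneg _) h3
    have h8 : ε * (-s / 2) ≤ ε * Real.exp (-s / 2) := mul_le_mul_of_nonneg_left h2 hε
    linarith [le_abs_self K]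
  calc Real.exp s * |Real.sqrt ε * w s|
      ≤ Real.exp s * ((|K| + 2 * ε) * Real.exp (-s / 2)) := by gcongr
    _ = (|K| + 2 * ε) * Real.exp (1 / 2 * s) *
          (Real.exp (1 / 2 * s) * Real.exp (-s / 2)) := by rw [h4]; ring
    _ = (|K| + 2 * ε) * Real.exp (1 / 2 * s) := by rw [h5, mul_one]

/-- The difference between `σ w` and the Ornstein-Uhlenbeck process is differentiable. -/
theorem hasDerivAt_sub_ouPath (hw : GoodPath ε K w) (hε : 0 ≤ ε) (t : ℝ) :
    HasDerivAt (fun t => Real.sqrt ε * w t - ouPath (Real.sqrt ε) w t)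
      (ouPath (Real.sqrt ε) w t) t := by
  have hc := hw.continuous
  have hg : Continuous fun s => Real.exp s * (Real.sqrt ε * w s) := by fun_prop
  have hint := hw.integrableOn_exp_mul hε
  have key : ∀ t, ouPath (Real.sqrt ε) w t =
      Real.sqrt ε * w t - Real.exp (-t) * ∫ r in Iic t, Real.exp r * (Real.sqrt ε * w r) := by
    intro t
    have h1 : ∀ s, Real.sqrt ε * (Real.exp s * (w (t + s) - w t)) =
        Real.exp (-t) * (Real.exp (t + s) * (Real.sqrt ε * w (t + s)))
          - Real.sqrt ε * w t * Real.exp s := by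
      intro s
      rw [← mul_assoc (Real.exp (-t)), ← Real.exp_add]
      ring_nf
    have hi : IntegrableOn (fun s => Real.exp (t + s) * (Real.sqrt ε * w (t + s))) (Iic 0) := by
      have h2 := (measurePreserving_add_left volume t).integrableOn_comp_preimage
        (measurableEmbedding_addLeft t) (f := fun s => Real.exp s * (Real.sqrt ε * w s))
        (s := Iic t) |>.2 (integrableOn_Iic_of_continuous hg hint t)
      convert! h2 using 1
      ext s
      simp
    rw [ouPath, neg_mul, ← integral_const_mul]
    simp only [h1]
    rw [integral_sub (hi.const_mul _) ((integrableOn_exp_Iic 0).const_mul _), integral_const_mul,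
      integral_const_mul, integral_exp_Iic_zero,
      integral_Iic_comp_add (fun s => Real.exp s * (Real.sqrt ε * w s))]
    ring
  have hY := (hasDerivAt_neg t).exp.mul (hasDerivAt_integral_Iic hg hint t)
  have hfun : (fun t => Real.sqrt ε * w t - ouPath (Real.sqrt ε) w t) =
      fun t => Real.exp (-t) * ∫ r in Iic t, Real.exp r * (Real.sqrt ε * w r) := by
    ext s
    rw [key]
    ring
  rw [hfun, key t]
  convert! hY using 1
  rw [← mul_assoc (Real.exp (-t)), ← Real.exp_add, neg_add_cancel, Real.exp_zero]
  ring

theorem continuous_ouPath (hw : GoodPath ε K w) (hε : 0 ≤ ε) :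
    Continuous (ouPath (Real.sqrt ε) w) := by
  have h1 : Continuous fun t => Real.sqrt ε * w t - ouPath (Real.sqrt ε) w t :=
    continuous_iff_continuousAt.2 fun t => (hw.hasDerivAt_sub_ouPath hε t).continuousAt
  have h2 : Continuous fun t => Real.sqrt ε * w t := continuous_const.mul hw.continuous
  convert h2.sub h1 using 1
  ext t
  simp

end GoodPath

namespace Setting

variable {H V : Type*} [NormedAddCommGroup H] [InnerProductSpace ℝ H] [CompleteSpace H]
  [NormedAddCommGroup V] [NormedSpace ℝ V] [CompleteSpace V] (S : Setting H V)

section Memory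

variable {lam K : ℝ} {w : ℝ → ℝ}

theorem M_eq (lam σ : ℝ) (w : ℝ → ℝ) (n : ℕ) (t : ℝ) :
    S.M lam σ w n t = Real.exp (-((2 * S.eps lam - S.β lam n) * t + σ * w t)) *
      ∫ r in Iic t, Real.exp ((2 * S.eps lam - S.β lam n) * r + σ * w r) := by
  rw [← integral_Iic_comp_add (fun r => Real.exp ((2 * S.eps lam - S.β lam n) * r + σ * w r)),
    ← integral_const_mul, M]
  congr 1
  ext s
  rw [← Real.exp_add]
  ring_nf

theorem M_nonneg (lam σ : ℝ) (w : ℝ → ℝ) (n : ℕ) (t : ℝ) : 0 ≤ S.M lam σ w n t :=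
  integral_nonneg fun _ => (Real.exp_pos _).le

theorem M_le (hw : GoodPath (S.eps lam) K w) {n : ℕ} {g : ℝ} (hg : 0 < g)
    (hε : 0 ≤ S.eps lam) (hn : S.β lam n ≤ -g) {t : ℝ} (ht : 0 ≤ t) :
    S.M lam (Real.sqrt (S.eps lam)) w n t ≤ Real.exp (2 * K + 2 * (S.eps lam * t)) / g := by
  set ε := S.eps lam with hεdef
  have ha : 0 < ε - S.β lam n := by linarith
  have h1 : S.M lam (Real.sqrt ε) w n t ≤
      ∫ s in Iic (0 : ℝ), Real.exp (2 * K + 2 * (ε * t)) * Real.exp ((ε - S.β lam n) * s) := by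
    refine integral_mono_of_nonneg (Eventually.of_forall fun _ => (Real.exp_pos _).le)
      ((integrableOn_exp_mul_Iic ha 0).const_mul _) ?_
    refine (ae_restrict_iff' measurableSet_Iic).2 (Eventually.of_forall fun s (hs : s ≤ 0) => ?_)
    dsimp only
    rw [← Real.exp_add, Real.exp_le_exp, ← hεdef]
    have h2 := (le_abs_self _).trans (hw.growth (t + s))
    have h3 := (neg_le_abs _).trans (hw.sigma_le ht)
    have h4 : |t + s| ≤ t - s := abs_le.2 ⟨by linarith, by linarith⟩
    have h5 := mul_le_mul_of_nonneg_left h4 hε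
    linarith
  refine h1.trans ?_
  rw [integral_const_mul, integral_exp_mul_Iic ha, mul_zero, Real.exp_zero, mul_one_div]
  gcongr
  linarith

end Memory

section Semigroup

variable {lam g : ℝ}

theorem orthonormal_e_succ (hl : lam ∈ S.Lam) :
    Orthonormal ℝ (fun n : ℕ => (S.e lam (n + 1) : H)) :=
  (S.e_orthonormal lam hl).comp _ (add_left_injective 1)

theorem norm_sum_expLs_le (hl : lam ∈ S.Lam) (hβ : ∀ n, 1 ≤ n → S.β lam n ≤ -g) {τ : ℝ}
    (hτ : 0 ≤ τ) (u : H) (s : Finset ℕ) :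
    ‖∑ n ∈ s, (Real.exp (S.β lam (n + 1) * τ) * ⟪u, (S.e lam (n + 1) : H)⟫_ℝ) •
      (S.e lam (n + 1) : H)‖ ≤ Real.exp (-g * τ) * ‖u‖ := by
  refine abs_le_of_sq_le_sq' ?_ (by positivity) |>.2
  have ho := S.orthonormal_e_succ hl
  have h1 := ho.inner_sum
    (fun n => Real.exp (S.β lam (n + 1) * τ) * ⟪u, (S.e lam (n + 1) : H)⟫_ℝ)
    (fun n => Real.exp (S.β lam (n + 1) * τ) * ⟪u, (S.e lam (n + 1) : H)⟫_ℝ) s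
  rw [real_inner_self_eq_norm_sq] at h1
  rw [h1, mul_pow]
  refine le_trans ?_ (mul_le_mul_of_nonneg_left (ho.sum_inner_products_le u (s := s)) (sq_nonneg _))
  rw [Finset.mul_sum]
  refine Finset.sum_le_sum fun n _ => ?_
  simp only [conj_trivial]
  rw [real_inner_comm u, Real.norm_eq_abs, sq_abs, ← sq, mul_pow]
  have h2 : Real.exp (S.β lam (n + 1) * τ) ≤ Real.exp (-g * τ) :=
    Real.exp_le_exp.2 (mul_le_mul_of_nonneg_right (hβ _ (by omega)) hτ)
  gcongr

theorem summable_expLs (hl : lam ∈ S.Lam) (hβ : ∀ n, 1 ≤ n → S.β lam n ≤ -g) (hg : 0 ≤ g) {τ : ℝ}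
    (hτ : 0 ≤ τ) (u : H) :
    Summable fun n : ℕ => (Real.exp (S.β lam (n + 1) * τ) * ⟪u, (S.e lam (n + 1) : H)⟫_ℝ) •
      (S.e lam (n + 1) : H) := by
  have ho := S.orthonormal_e_succ hl
  have h1 := (ho.orthogonalFamily.summable_iff_norm_sq_summable
    (fun n => Real.exp (S.β lam (n + 1) * τ) * ⟪u, (S.e lam (n + 1) : H)⟫_ℝ)).2 ?_
  · simpa using h1
  · refine Summable.of_nonneg_of_le (fun n => sq_nonneg _) (fun n => ?_)
      (ho.inner_products_summable u)
    rw [real_inner_comm u, norm_mul, Real.norm_eq_abs, Real.abs_exp]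
    have h2 : Real.exp (S.β lam (n + 1) * τ) ≤ 1 :=
      Real.exp_le_one_iff.2 (mul_nonpos_of_nonpos_of_nonneg
        ((hβ _ (by omega)).trans (by linarith)) hτ)
    gcongr
    exact mul_le_of_le_one_left (norm_nonneg _) h2

theorem norm_expLs_le (hl : lam ∈ S.Lam) (hβ : ∀ n, 1 ≤ n → S.β lam n ≤ -g) (hg : 0 ≤ g) {τ : ℝ}
    (hτ : 0 ≤ τ) (u : H) : ‖S.expLs lam τ u‖ ≤ Real.exp (-g * τ) * ‖u‖ :=
  le_of_tendsto (S.summable_expLs hl hβ hg hτ u).hasSum.norm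
    (Eventually.of_forall fun s => S.norm_sum_expLs_le hl hβ hτ u s)

theorem expLs_sub (hl : lam ∈ S.Lam) (hβ : ∀ n, 1 ≤ n → S.β lam n ≤ -g) (hg : 0 ≤ g) {τ : ℝ}
    (hτ : 0 ≤ τ) (u v : H) : S.expLs lam τ (u - v) = S.expLs lam τ u - S.expLs lam τ v := by
  rw [expLs, expLs, expLs, ← (S.summable_expLs hl hβ hg hτ u).tsum_sub
    (S.summable_expLs hl hβ hg hτ v)]
  congr 1
  ext1 n
  rw [inner_sub_left, mul_sub, sub_smul]

theorem inner_expLs (hl : lam ∈ S.Lam) (hβ : ∀ n, 1 ≤ n → S.β lam n ≤ -g) (hg : 0 ≤ g) {τ : ℝ}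
    (hτ : 0 ≤ τ) (u : H) (n : ℕ) : ⟪S.expLs lam τ u, (S.e lam (n + 1) : H)⟫_ℝ =
      Real.exp (S.β lam (n + 1) * τ) * ⟪u, (S.e lam (n + 1) : H)⟫_ℝ := by
  have h1 := (innerSL ℝ (S.e lam (n + 1) : H)).hasSum (S.summable_expLs hl hβ hg hτ u).hasSum
  have h2 := (hasSum_ite_eq n (Real.exp (S.β lam (n + 1) * τ) * ⟪u, (S.e lam (n + 1) : H)⟫_ℝ))
  rw [real_inner_comm]
  refine h1.unique (h2.congr_fun fun m => ?_)
  have ho := orthonormal_iff_ite.1 (S.orthonormal_e_succ hl) n m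
  simp only [innerSL_apply_apply, inner_smul_right, ho]
  by_cases h : m = n
  · simp [h]
  · simp [h, Ne.symm h]

theorem inner_expLs_zero (hl : lam ∈ S.Lam) (hβ : ∀ n, 1 ≤ n → S.β lam n ≤ -g) (hg : 0 ≤ g) {τ : ℝ}
    (hτ : 0 ≤ τ) (u : H) : ⟪S.expLs lam τ u, (S.e lam 0 : H)⟫_ℝ = 0 := by
  have h1 := (innerSL ℝ (S.e lam 0 : H)).hasSum (S.summable_expLs hl hβ hg hτ u).hasSum
  rw [real_inner_comm]
  refine h1.unique (hasSum_zero.congr_fun fun m => ?_)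
  have ho := orthonormal_iff_ite.1 (S.e_orthonormal lam hl) 0 (m + 1)
  simp [ho]

/-- The integrands of the stochastic convolutions are integrable. -/
theorem intervalIntegrable_expLs (hl : lam ∈ S.Lam) (hβ : ∀ n, 1 ≤ n → S.β lam n ≤ -g)
    (hg : 0 ≤ g) {t : ℝ} (ht : 0 ≤ t) {ρ : ℝ → ℝ} {D : ℝ → H} (hρ : ContinuousOn ρ (Icc 0 t))
    (hD : ContinuousOn D (Icc 0 t)) :
    IntervalIntegrable (fun s => ρ s • S.expLs lam (t - s) (D s)) volume 0 t := by
  rw [intervalIntegrable_iff_integrableOn_Icc_of_le ht]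
  have hb : IntegrableOn (fun s => |ρ s| * ‖D s‖) (Icc 0 t) :=
    (hρ.abs.mul hD.norm).integrableOn_Icc
  refine hb.mono' (AEStronglyMeasurable.smul (hρ.aestronglyMeasurable measurableSet_Icc) ?_) ?_
  · refine aestronglyMeasurable_of_tendsto_ae atTop
      (f := fun (N : ℕ) s => ∑ n ∈ Finset.range N, (Real.exp (S.β lam (n + 1) * (t - s)) *
        ⟪D s, (S.e lam (n + 1) : H)⟫_ℝ) • (S.e lam (n + 1) : H)) (fun N => ?_) ?_
    · refine ContinuousOn.aestronglyMeasurable ?_ measurableSet_Icc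
      refine continuousOn_finsetSum _ fun n _ => ContinuousOn.smul (ContinuousOn.mul ?_ ?_)
        continuousOn_const
      · fun_prop
      · exact hD.inner continuousOn_const
    · refine (ae_restrict_iff' measurableSet_Icc).2 (Eventually.of_forall fun s hs => ?_)
      exact (S.summable_expLs hl hβ hg (sub_nonneg.2 hs.2) (D s)).hasSum.tendsto_sum_nat
  · refine (ae_restrict_iff' measurableSet_Icc).2 (Eventually.of_forall fun s hs => ?_)
    rw [norm_smul, Real.norm_eq_abs]
    gcongr
    refine (S.norm_expLs_le hl hβ hg (sub_nonneg.2 hs.2) (D s)).trans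
      (mul_le_of_le_one_left (norm_nonneg _) ?_)
    exact Real.exp_le_one_iff.2 (by nlinarith [hs.2])

end Semigroup

end Setting

end Pitchfork

namespace Pitchfork

namespace Setting

variable {H V : Type*} [NormedAddCommGroup H] [InnerProductSpace ℝ H] [CompleteSpace H]
  [NormedAddCommGroup V] [NormedSpace ℝ V] [CompleteSpace V] (S : Setting H V)

/-- A solution of the surrogate system along a good noise path, initialized on the
parameterization. -/
structure SurrogatePath (lam K : ℝ) (w x : ℝ → ℝ) (φ : ℝ → V) : Prop where
  mem : lam ∈ Ioc S.lamC S.lamStar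
  good : GoodPath (S.eps lam) K w
  diss : S.Dissipative lam (Real.sqrt (S.eps lam)) w
  sol : S.IsPathSolution lam (Real.sqrt (S.eps lam)) w x φ
  initial : φ 0 = S.param lam (Real.sqrt (S.eps lam)) w (x 0) 0

/-- The functional `F_c` as a continuous linear map. -/
noncomputable def FcCLM (lam : ℝ) : V →L[ℝ] ℝ :=
  (innerSL ℝ (S.e lam 0 : H)) ∘L (S.B (S.eV lam 0) + S.B.flip (S.eV lam 0))

theorem FcCLM_apply (lam : ℝ) (v : V) : S.FcCLM lam v = S.Fc lam v := by
  simp [FcCLM, Fc, Pi1, real_inner_comm, inner_add_right]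

theorem Fc_eV (lam : ℝ) (n : ℕ) :
    S.Fc lam (S.eV lam n) = S.Bcoef lam 0 0 n + S.Bcoef lam 0 n 0 := by
  simp [Fc, Pi1, Bcoef, inner_add_left]

theorem Fc_param (lam σ : ℝ) (w : ℝ → ℝ) (x t : ℝ) : S.Fc lam (S.param lam σ w x t) =
    x ^ 2 * ∑ n ∈ Finset.Ico 1 S.N, S.Bcoef lam n 0 0 * S.M lam σ w n t *
      (S.Bcoef lam 0 0 n + S.Bcoef lam 0 n 0) := by
  rw [← FcCLM_apply, param, map_sum, Finset.mul_sum]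
  refine Finset.sum_congr rfl fun n _ => ?_
  rw [map_smul, FcCLM_apply, Fc_eV, smul_eq_mul]
  ring

theorem inner_Pis {lam : ℝ} (hl : lam ∈ S.Lam) (u : H) {n : ℕ} (hn : 1 ≤ n) :
    ⟪S.Pis lam u, (S.e lam n : H)⟫_ℝ = ⟪u, (S.e lam n : H)⟫_ℝ := by
  have ho := (S.e_orthonormal lam hl).2 (show 0 ≠ n by omega)
  rw [Pis, inner_sub_left, real_inner_smul_left, ho, mul_zero, sub_zero]

theorem norm_Pis_le {lam : ℝ} (hl : lam ∈ S.Lam) (u : H) : ‖S.Pis lam u‖ ≤ 2 * ‖u‖ := by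
  have h1 : |⟪u, (S.e lam 0 : H)⟫_ℝ| ≤ ‖u‖ * ‖(S.e lam 0 : H)‖ := abs_real_inner_le_norm _ _
  rw [S.norm_e hl, mul_one] at h1
  refine (norm_sub_le _ _).trans ?_
  rw [norm_smul, S.norm_e hl, mul_one, Real.norm_eq_abs]
  simp only [Pi1]
  linarith

theorem continuous_Pis (lam : ℝ) : Continuous (S.Pis lam) := by
  unfold Pis Pi1
  fun_prop

theorem emb_eV (lam : ℝ) (n : ℕ) : S.emb (S.eV lam n) = (S.e lam n : H) := S.emb_incl _

theorem inner_emb_param {lam : ℝ} (hl : lam ∈ Icc S.lamC S.lamStar) (σ : ℝ) (w : ℝ → ℝ) (x t : ℝ)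
    {n : ℕ} (hn : 1 ≤ n) : ⟪S.emb (S.param lam σ w x t), (S.e lam n : H)⟫_ℝ =
      S.Bcoef lam n 0 0 * S.M lam σ w n t * x ^ 2 := by
  have ho := orthonormal_iff_ite.1 (S.e_orthonormal lam (S.Lam_of_Icc hl))
  simp only [param, map_sum, map_smul, emb_eV, sum_inner, real_inner_smul_left, ho, mul_ite,
    mul_one, mul_zero, Finset.sum_ite_eq', Finset.mem_Ico]
  split_ifs with h
  · rfl
  · have : S.Bcoef lam n 0 0 = 0 := S.interaction_zero lam hl n (by omega)
    simp [this]

theorem inner_emb_param_zero {lam : ℝ} (hl : lam ∈ Icc S.lamC S.lamStar) (σ : ℝ) (w : ℝ → ℝ)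
    (x t : ℝ) : ⟪S.emb (S.param lam σ w x t), (S.e lam 0 : H)⟫_ℝ = 0 := by
  have ho := orthonormal_iff_ite.1 (S.e_orthonormal lam (S.Lam_of_Icc hl))
  simp [param, emb_eV, sum_inner, real_inner_smul_left, ho]

namespace SurrogatePath

variable {S} {lam K : ℝ} {w x : ℝ → ℝ} {φ : ℝ → V}

theorem mem_Icc (h : S.SurrogatePath lam K w x φ) : lam ∈ Icc S.lamC S.lamStar :=
  ⟨h.mem.1.le, h.mem.2⟩

theorem mem_Lam (h : S.SurrogatePath lam K w x φ) : lam ∈ S.Lam := S.Lam_of_Icc h.mem_Icc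

theorem eps_pos (h : S.SurrogatePath lam K w x φ) : 0 < S.eps lam :=
  S.critical_pos lam h.mem_Lam h.mem.1

theorem hasDerivAt_exp_neg_mul (h : S.SurrogatePath lam K w x φ) {v : ℝ → ℝ} {D t : ℝ}
    (hv : HasDerivAt (fun r => Real.exp (-ouPath (Real.sqrt (S.eps lam)) w r) * v r) D t) :
    HasDerivAt (fun r => Real.exp (-(Real.sqrt (S.eps lam) * w r)) * v r)
      (Real.exp (-(Real.sqrt (S.eps lam) * w t - ouPath (Real.sqrt (S.eps lam)) w t)) *
        (D - ouPath (Real.sqrt (S.eps lam)) w t *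
          (Real.exp (-ouPath (Real.sqrt (S.eps lam)) w t) * v t))) t := by
  have hY := (h.good.hasDerivAt_sub_ouPath h.eps_pos.le t).neg.exp
  convert! hY.mul hv using 1
  · ext r
    simp only [Pi.mul_apply, Pi.neg_apply]
    rw [← mul_assoc, ← Real.exp_add]
    ring_nf
  · simp only [Pi.neg_apply]
    ring

theorem continuousOn_exp_ouPath (h : S.SurrogatePath lam K w x φ) (s : Set ℝ) :
    ContinuousOn (fun t => Real.exp (ouPath (Real.sqrt (S.eps lam)) w t)) s :=
  (Real.continuous_exp.comp (h.good.continuous_ouPath h.eps_pos.le)).continuousOn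

theorem continuousOn_x (h : S.SurrogatePath lam K w x φ) : ContinuousOn x (Ici 0) := by
  refine ((h.continuousOn_exp_ouPath _).mul h.sol.continuous_x).congr fun t _ => ?_
  change x t = Real.exp (ouPath (Real.sqrt (S.eps lam)) w t) *
    (Real.exp (-ouPath (Real.sqrt (S.eps lam)) w t) * x t)
  rw [← mul_assoc, ← Real.exp_add, add_neg_cancel, Real.exp_zero, one_mul]

theorem continuousOn_φ (h : S.SurrogatePath lam K w x φ) : ContinuousOn φ (Ici 0) := by
  refine ((h.continuousOn_exp_ouPath _).smul h.sol.continuous_φ).congr fun t _ => ?_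
  change φ t = Real.exp (ouPath (Real.sqrt (S.eps lam)) w t) •
    (Real.exp (-ouPath (Real.sqrt (S.eps lam)) w t) • φ t)
  rw [smul_smul, ← Real.exp_add, add_neg_cancel, Real.exp_zero, one_smul]

theorem continuousOn_Fc (h : S.SurrogatePath lam K w x φ) :
    ContinuousOn (fun t => S.Fc lam (φ t)) (Ici 0) := by
  simp only [← FcCLM_apply]
  exact (S.FcCLM lam).continuous.comp_continuousOn h.continuousOn_φ

theorem continuous_exp_neg (h : S.SurrogatePath lam K w x φ) :
    Continuous fun t => Real.exp (-(Real.sqrt (S.eps lam) * w t)) := by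
  have := h.good.continuous
  fun_prop

/-- The amplitude equation after removal of the noise. -/
theorem hasDerivAt_amplitude (h : S.SurrogatePath lam K w x φ) {t : ℝ} (ht : 0 < t) :
    HasDerivAt (fun r => Real.exp (-(Real.sqrt (S.eps lam) * w r)) * x r)
      (S.eps lam * (Real.exp (-(Real.sqrt (S.eps lam) * w t)) * x t) +
        S.Fc lam (φ t) * (Real.exp (-(Real.sqrt (S.eps lam) * w t)) * x t)) t := by
  have h1 := h.hasDerivAt_exp_neg_mul (h.sol.eq_x t ht)
  convert h1 using 1
  rw [← FcCLM_apply, ← FcCLM_apply, map_smul, smul_eq_mul]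
  set Z := ouPath (Real.sqrt (S.eps lam)) w t
  have e1 : Real.exp (-(Real.sqrt (S.eps lam) * w t)) =
      Real.exp (-(Real.sqrt (S.eps lam) * w t - Z)) * Real.exp (-Z) := by
    rw [← Real.exp_add]; ring_nf
  have e2 : Real.exp Z * Real.exp (-Z) = 1 := by rw [← Real.exp_add, add_neg_cancel, Real.exp_zero]
  rw [e1]
  linear_combination (-(Real.exp (-(Real.sqrt (S.eps lam) * w t - Z)) * Real.exp (-Z) * x t *
    S.FcCLM lam (φ t))) * e2

/-- The equations of the stable modes after removal of the noise. -/
theorem hasDerivAt_mode (h : S.SurrogatePath lam K w x φ) {n : ℕ} (hn : 1 ≤ n) {t : ℝ}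
    (ht : 0 < t) :
    HasDerivAt
      (fun r => Real.exp (-(Real.sqrt (S.eps lam) * w r)) * ⟪S.emb (φ r), (S.e lam n : H)⟫_ℝ)
      (S.β lam n *
        (Real.exp (-(Real.sqrt (S.eps lam) * w t)) * ⟪S.emb (φ t), (S.e lam n : H)⟫_ℝ) +
        Real.exp (-(Real.sqrt (S.eps lam) * w t)) * (x t ^ 2 * S.Bcoef lam n 0 0 +
          2 * S.Fc lam (φ t) * ⟪S.emb (φ t), (S.e lam n : H)⟫_ℝ)) t := by
  obtain ⟨ψ, hψ, -, hder⟩ := h.sol.eq_φ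
  have h0 := (innerSL ℝ (S.e lam n : H)).hasFDerivAt.comp_hasDerivAt t (hder t ht)
  have h1 : HasDerivAt (fun r => Real.exp (-ouPath (Real.sqrt (S.eps lam)) w r) *
      ⟪S.emb (φ r), (S.e lam n : H)⟫_ℝ) _ t := h0.congr_of_eventuallyEq
    (Eventually.of_forall fun r => by simp [inner_smul_right, real_inner_comm])
  convert h.hasDerivAt_exp_neg_mul h1 using 1
  set Z := ouPath (Real.sqrt (S.eps lam)) w t
  have hB : ⟪S.B11s lam, (S.e lam n : H)⟫_ℝ = S.Bcoef lam n 0 0 := S.inner_Pis h.mem_Lam _ hn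
  have hL : ⟪S.Pis lam (S.L lam (ψ t)), (S.e lam n : H)⟫_ℝ =
      S.β lam n * (Real.exp (-Z) * ⟪S.emb (φ t), (S.e lam n : H)⟫_ℝ) := by
    rw [S.inner_Pis h.mem_Lam _ hn, ← linL_eq_L, S.inner_linL_e h.mem_Lam, ← S.emb_incl, hψ t ht,
      map_smul, real_inner_smul_left]
  have e1 : Real.exp (-(Real.sqrt (S.eps lam) * w t)) =
      Real.exp (-(Real.sqrt (S.eps lam) * w t - Z)) * Real.exp (-Z) := by
    rw [← Real.exp_add]; ring_nf
  have e2 : Real.exp Z * Real.exp (-Z) = 1 := by rw [← Real.exp_add, add_neg_cancel, Real.exp_zero]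
  rw [e1, innerSL_apply_apply, real_inner_comm _ (S.e lam n : H), inner_add_left, inner_add_left, hL,
    ← FcCLM_apply, ← FcCLM_apply, map_smul, map_smul, smul_eq_mul, real_inner_smul_left,
    real_inner_smul_left, real_inner_smul_left, inner_add_left, real_inner_smul_left,
    real_inner_smul_left, real_inner_smul_left, hB]
  linear_combination (-(Real.exp (-(Real.sqrt (S.eps lam) * w t - Z)) * Real.exp (-Z) *
    (x t ^ 2 * S.Bcoef lam n 0 0 +
      2 * S.FcCLM lam (φ t) * ⟪S.emb (φ t), (S.e lam n : H)⟫_ℝ))) * e2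

theorem continuousOn_mode (h : S.SurrogatePath lam K w x φ) (n : ℕ) :
    ContinuousOn (fun t => ⟪S.emb (φ t), (S.e lam n : H)⟫_ℝ) (Ici 0) :=
  (S.emb.continuous.comp_continuousOn h.continuousOn_φ).inner continuousOn_const

/-- The modes of the solution stay on the parameterization. -/
theorem mode_eq (h : S.SurrogatePath lam K w x φ) {n : ℕ} (hn : 1 ≤ n) {t : ℝ} (ht : 0 ≤ t) :
    ⟪S.emb (φ t), (S.e lam n : H)⟫_ℝ =
      S.Bcoef lam n 0 0 * S.M lam (Real.sqrt (S.eps lam)) w n t * x t ^ 2 := by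
  set ε := S.eps lam with hε
  set a := 2 * ε - S.β lam n with ha
  have hεpos : 0 < ε := h.eps_pos
  have hβ := S.stable_neg lam h.mem_Icc n hn
  have hwc := h.good.continuous
  have hgc : Continuous fun r => Real.exp (a * r + Real.sqrt ε * w r) := by fun_prop
  have hJ := hasDerivAt_integral_Iic hgc (h.good.integrableOn_exp (by linarith))
  set J : ℝ → ℝ := fun t => ∫ r in Iic t, Real.exp (a * r + Real.sqrt ε * w r) with hJdef
  have hJc : Continuous J := continuous_iff_continuousAt.2 fun t => (hJ t).continuousAt
  have hM : ∀ t, S.M lam (Real.sqrt ε) w n t = Real.exp (-(a * t + Real.sqrt ε * w t)) * J t :=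
    fun t => S.M_eq lam _ w n t
  let p : ℝ → ℝ := fun r => Real.exp (-(Real.sqrt ε * w r)) * x r
  have hpc : ContinuousOn p (Ici 0) := h.continuous_exp_neg.continuousOn.mul h.continuousOn_x
  let m : ℝ → ℝ := fun r => S.Bcoef lam n 0 0 * (Real.exp (-(a * r)) * J r * p r ^ 2)
  have hm : ∀ r, 0 < r → HasDerivAt m ((S.β lam n + 2 * S.Fc lam (φ r)) * m r +
      S.Bcoef lam n 0 0 * (Real.exp (Real.sqrt ε * w r) * p r ^ 2)) r := by
    intro r hr
    have h1 : HasDerivAt (fun r => -(a * r)) (-a) r := by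
      convert! ((hasDerivAt_id r).const_mul a).neg using 1
      rw [mul_one]
    have h2 := (h.hasDerivAt_amplitude hr).pow 2
    convert! ((h1.exp.mul (hJ r)).mul h2).const_mul (S.Bcoef lam n 0 0) using 1
    have e1 : Real.exp (Real.sqrt ε * w r) =
        Real.exp (-(a * r)) * Real.exp (a * r + Real.sqrt ε * w r) := by
      rw [← Real.exp_add]; ring_nf
    rw [e1]
    simp only [Pi.mul_apply, Pi.pow_apply, m, p, ha, ← hε]
    push_cast
    ring
  have hmval : ∀ r, m r = Real.exp (-(Real.sqrt ε * w r)) *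
      (S.Bcoef lam n 0 0 * S.M lam (Real.sqrt ε) w n r * x r ^ 2) := by
    intro r
    simp only [m, p, hM]
    rw [neg_add, Real.exp_add]
    ring
  let q : ℝ → ℝ := fun r => Real.exp (-(Real.sqrt ε * w r)) * ⟪S.emb (φ r), (S.e lam n : H)⟫_ℝ
  have hzero := eqOn_zero_of_hasDerivAt_mul (d := fun r => q r - m r)
    (g := fun r => S.β lam n + 2 * S.Fc lam (φ r))
    ((h.continuous_exp_neg.continuousOn.mul (h.continuousOn_mode n)).sub
      (continuousOn_const.mul ((ContinuousOn.mul (by fun_prop) hJc.continuousOn).mul (hpc.pow 2))))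
    (continuousOn_const.add (continuousOn_const.mul h.continuousOn_Fc)) ?_ ?_ ht
  · rw [hmval, sub_eq_zero] at hzero
    exact mul_left_cancel₀ (Real.exp_ne_zero _) hzero
  · rw [hmval, sub_eq_zero]
    simp only [q]
    rw [h.initial, S.inner_emb_param h.mem_Icc _ _ _ _ hn]
  · intro r hr
    convert! (h.hasDerivAt_mode hn hr).sub (hm r hr) using 1
    have e1 : Real.exp (Real.sqrt ε * w r) * Real.exp (-(Real.sqrt ε * w r)) = 1 := by
      rw [← Real.exp_add, add_neg_cancel, Real.exp_zero]
    simp only [q, p, ← hε]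
    linear_combination (S.Bcoef lam n 0 0 * x r ^ 2 * Real.exp (-(Real.sqrt ε * w r))) * e1

/-- The stable component of the solution is slaved to the critical one. -/
theorem eq_param (h : S.SurrogatePath lam K w x φ) {t : ℝ} (ht : 0 ≤ t) :
    φ t = S.param lam (Real.sqrt (S.eps lam)) w (x t) t := by
  refine S.emb_injective (S.ext_inner_e h.mem_Lam fun n => ?_)
  rcases Nat.eq_zero_or_pos n with rfl | hn
  · rw [S.inner_emb_param_zero h.mem_Icc]
    exact h.sol.stable t ht
  · rw [S.inner_emb_param h.mem_Icc _ _ _ _ hn, h.mode_eq hn ht]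

theorem Fc_nonpos (h : S.SurrogatePath lam K w x φ) {t : ℝ} (ht : 0 ≤ t) :
    S.Fc lam (φ t) ≤ 0 := by
  rw [h.eq_param ht, Fc_param]
  exact mul_nonpos_of_nonneg_of_nonpos (sq_nonneg _) (h.diss t ht).le

theorem abs_x_le (h : S.SurrogatePath lam K w x φ) {t : ℝ} (ht : 0 ≤ t) :
    |x t| ≤ Real.exp (K + 2 * (S.eps lam * t)) * |x 0| := by
  have h1 := abs_le_of_hasDerivAt_nonpos
    (h.continuous_exp_neg.continuousOn.mul h.continuousOn_x)
    (fun s hs => h.hasDerivAt_amplitude hs) (fun s hs => h.Fc_nonpos hs.le) ht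
  simp only [Pi.mul_apply, h.good.zero, mul_zero, neg_zero, Real.exp_zero, one_mul, abs_mul,
    Real.abs_exp] at h1
  rw [Real.exp_neg, inv_mul_le_iff₀ (Real.exp_pos _), ← mul_assoc, ← Real.exp_add] at h1
  refine h1.trans ?_
  refine mul_le_mul_of_nonneg_right (Real.exp_le_exp.2 ?_) (abs_nonneg _)
  have := (le_abs_self _).trans (h.good.sigma_le ht)
  linarith

/-- The critical residual only involves the self-interaction of the stable component. -/
theorem R1_eq (h : S.SurrogatePath lam K w x φ) {t : ℝ} (ht : 0 ≤ t) :
    S.R1 lam (Real.sqrt (S.eps lam)) w x φ t =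
      -∫ s in (0 : ℝ)..t, Real.exp (S.eps lam * (t - s) + Real.sqrt (S.eps lam) * (w t - w s)) *
        S.Pi1 lam (S.B (φ s) (φ s)) := by
  have hwc := h.good.continuous
  have hpc := h.continuous_exp_neg.continuousOn.mul h.continuousOn_x
  have h1 := variation_of_constants hpc (h.continuousOn_Fc.mul hpc)
    (fun s hs => h.hasDerivAt_amplitude hs) ht
  have hkc : Continuous fun s =>
    Real.exp (S.eps lam * (t - s) + Real.sqrt (S.eps lam) * (w t - w s)) := by fun_prop
  have hi1 : IntervalIntegrable (fun s =>
      Real.exp (S.eps lam * (t - s) + Real.sqrt (S.eps lam) * (w t - w s)) *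
        (x s * S.Fc lam (φ s))) volume 0 t :=
    ContinuousOn.intervalIntegrable_of_Icc ht ((hkc.continuousOn.mul
      (h.continuousOn_x.mul h.continuousOn_Fc)).mono fun r hr => hr.1)
  have hi2 : IntervalIntegrable (fun s =>
      Real.exp (S.eps lam * (t - s) + Real.sqrt (S.eps lam) * (w t - w s)) *
        S.Pi1 lam (S.B (φ s) (φ s))) volume 0 t := by
    refine ContinuousOn.intervalIntegrable_of_Icc ht ((hkc.continuousOn.mul
      ?_).mono (fun r hr => hr.1 : Icc 0 t ⊆ Ici 0))
    exact ((S.B.continuous.comp_continuousOn h.continuousOn_φ).clm_apply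
      h.continuousOn_φ).inner continuousOn_const
  have h2 : x t - Real.exp (S.eps lam * t + Real.sqrt (S.eps lam) * w t) * x 0 =
      ∫ s in (0 : ℝ)..t, Real.exp (S.eps lam * (t - s) + Real.sqrt (S.eps lam) * (w t - w s)) *
        (x s * S.Fc lam (φ s)) := by
    have h3 : ∀ s, Real.exp (S.eps lam * (t - s) + Real.sqrt (S.eps lam) * (w t - w s)) *
        (x s * S.Fc lam (φ s)) = Real.exp (Real.sqrt (S.eps lam) * w t) *
        (Real.exp (S.eps lam * (t - s)) *
          (S.Fc lam (φ s) * (Real.exp (-(Real.sqrt (S.eps lam) * w s)) * x s))) := by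
      intro s
      rw [show S.eps lam * (t - s) + Real.sqrt (S.eps lam) * (w t - w s) =
        Real.sqrt (S.eps lam) * w t + S.eps lam * (t - s) + -(Real.sqrt (S.eps lam) * w s) by ring,
        Real.exp_add, Real.exp_add]
      ring
    simp only [h3]
    rw [intervalIntegral.integral_const_mul]
    simp only [Pi.mul_apply, h.good.zero, mul_zero, neg_zero, Real.exp_zero, one_mul] at h1
    rw [← h1, Real.exp_add]
    have e1 : Real.exp (Real.sqrt (S.eps lam) * w t) *
        Real.exp (-(Real.sqrt (S.eps lam) * w t)) = 1 := by
      rw [← Real.exp_add, add_neg_cancel, Real.exp_zero]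
    linear_combination (-(x t)) * e1
  rw [R1, h2]
  simp only [E1, mul_add]
  rw [intervalIntegral.integral_add hi1 hi2]
  ring

/-- The nonlinear part of the stable component of the surrogate system. -/
theorem continuousOn_surrogate_nonlinearity (h : S.SurrogatePath lam K w x φ) :
    ContinuousOn (fun s => x s ^ 2 • S.B11s lam + (2 * S.Fc lam (φ s)) • S.emb (φ s)) (Ici 0) :=
  ((h.continuousOn_x.pow 2).smul continuousOn_const).add
    ((continuousOn_const.mul h.continuousOn_Fc).smul
      (S.emb.continuous.comp_continuousOn h.continuousOn_φ))

theorem continuousOn_E2 (h : S.SurrogatePath lam K w x φ) :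
    ContinuousOn (fun s => S.E2 lam (x s) (φ s)) (Ici 0) := by
  refine (((h.continuousOn_x.pow 2).smul continuousOn_const).add
    (h.continuousOn_x.smul ((S.continuous_Pis lam).comp_continuousOn ?_))).add
    ((S.continuous_Pis lam).comp_continuousOn ?_)
  · exact ((S.B (S.eV lam 0)).continuous.comp_continuousOn h.continuousOn_φ).add
      ((S.B.continuous.comp_continuousOn h.continuousOn_φ).clm_apply continuousOn_const)
  · exact (S.B.continuous.comp_continuousOn h.continuousOn_φ).clm_apply h.continuousOn_φ

/-- Mild form of the stable component of the surrogate system. -/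
theorem mild_stable (h : S.SurrogatePath lam K w x φ) {g : ℝ} (hg : 0 ≤ g)
    (hβ : ∀ n, 1 ≤ n → S.β lam n ≤ -g) {t : ℝ} (ht : 0 ≤ t) :
    S.emb (φ t) - Real.exp (Real.sqrt (S.eps lam) * w t) • S.expLs lam t (S.emb (φ 0)) =
      ∫ s in (0 : ℝ)..t, Real.exp (Real.sqrt (S.eps lam) * (w t - w s)) • S.expLs lam (t - s)
        (x s ^ 2 • S.B11s lam + (2 * S.Fc lam (φ s)) • S.emb (φ s)) := by
  have hl := h.mem_Lam
  have hwc := h.good.continuous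
  have hkc : Continuous fun s => Real.exp (Real.sqrt (S.eps lam) * (w t - w s)) := by fun_prop
  have hint := S.intervalIntegrable_expLs hl hβ hg ht hkc.continuousOn
    (h.continuousOn_surrogate_nonlinearity.mono fun r hr => hr.1)
  refine S.ext_inner_e hl fun n => ?_
  have hinner : ∀ u : ℝ → H, IntervalIntegrable u volume 0 t →
      ⟪∫ s in (0 : ℝ)..t, u s, (S.e lam n : H)⟫_ℝ =
        ∫ s in (0 : ℝ)..t, ⟪u s, (S.e lam n : H)⟫_ℝ := by
    intro u hu
    have := (innerSL ℝ (S.e lam n : H)).intervalIntegral_comp_comm hu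
    simp only [innerSL_apply_apply] at this
    simp only [real_inner_comm (S.e lam n : H)]
    exact this.symm
  rw [hinner _ hint, inner_sub_left, real_inner_smul_left]
  rcases Nat.eq_zero_or_pos n with rfl | hn
  · rw [S.inner_expLs_zero hl hβ hg ht, show ⟪S.emb (φ t), (S.e lam 0 : H)⟫_ℝ = 0 from
      h.sol.stable t ht, intervalIntegral.integral_congr (g := fun _ => 0)]
    · simp
    · intro s hs
      rw [uIcc_of_le ht] at hs
      simp only [real_inner_smul_left]
      rw [S.inner_expLs_zero hl hβ hg (sub_nonneg.2 hs.2), mul_zero]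
  · obtain ⟨k, rfl⟩ : ∃ k, n = k + 1 := ⟨n - 1, by omega⟩
    have hB : ⟪S.B11s lam, (S.e lam (k + 1) : H)⟫_ℝ = S.Bcoef lam (k + 1) 0 0 :=
      S.inner_Pis hl _ hn
    have h1 := variation_of_constants
      (h.continuous_exp_neg.continuousOn.mul (h.continuousOn_mode (k + 1)))
      (h := fun t => Real.exp (-(Real.sqrt (S.eps lam) * w t)) *
        (x t ^ 2 * S.Bcoef lam (k + 1) 0 0 +
          2 * S.Fc lam (φ t) * ⟪S.emb (φ t), (S.e lam (k + 1) : H)⟫_ℝ))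
      (h.continuous_exp_neg.continuousOn.mul (((h.continuousOn_x.pow 2).mul continuousOn_const).add
        ((continuousOn_const.mul h.continuousOn_Fc).mul (h.continuousOn_mode (k + 1)))))
      (fun s hs => h.hasDerivAt_mode hn hs) ht
    simp only [Pi.mul_apply, h.good.zero, mul_zero, neg_zero, Real.exp_zero, one_mul] at h1
    rw [S.inner_expLs hl hβ hg ht]
    have h2 := congrArg (fun r => Real.exp (Real.sqrt (S.eps lam) * w t) * r) h1
    simp only [← intervalIntegral.integral_const_mul] at h2
    have e1 : Real.exp (Real.sqrt (S.eps lam) * w t) *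
        Real.exp (-(Real.sqrt (S.eps lam) * w t)) = 1 := by
      rw [← Real.exp_add, add_neg_cancel, Real.exp_zero]
    rw [mul_sub, ← mul_assoc, e1, one_mul] at h2
    rw [h2]
    refine intervalIntegral.integral_congr fun s hs => ?_
    rw [uIcc_of_le ht] at hs
    simp only [real_inner_smul_left]
    rw [S.inner_expLs hl hβ hg (sub_nonneg.2 hs.2), inner_add_left, real_inner_smul_left,
      real_inner_smul_left, hB, show Real.sqrt (S.eps lam) * (w t - w s) =
        Real.sqrt (S.eps lam) * w t + -(Real.sqrt (S.eps lam) * w s) by ring, Real.exp_add]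
    ring

theorem R2_eq (h : S.SurrogatePath lam K w x φ) {g : ℝ} (hg : 0 ≤ g)
    (hβ : ∀ n, 1 ≤ n → S.β lam n ≤ -g) {t : ℝ} (ht : 0 ≤ t) :
    S.R2 lam (Real.sqrt (S.eps lam)) w x φ t =
      ∫ s in (0 : ℝ)..t, Real.exp (Real.sqrt (S.eps lam) * (w t - w s)) • S.expLs lam (t - s)
        ((2 * S.Fc lam (φ s)) • S.emb (φ s) -
          (x s • S.Fs lam (φ s) + S.Pis lam (S.B (φ s) (φ s)))) := by
  have hl := h.mem_Lam
  have hwc := h.good.continuous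
  have hkc : Continuous fun s => Real.exp (Real.sqrt (S.eps lam) * (w t - w s)) := by fun_prop
  have hi1 := S.intervalIntegrable_expLs hl hβ hg ht hkc.continuousOn
    (h.continuousOn_surrogate_nonlinearity.mono fun r hr => hr.1)
  have hi2 := S.intervalIntegrable_expLs hl hβ hg ht hkc.continuousOn
    (h.continuousOn_E2.mono fun r hr => hr.1)
  rw [R2, h.mild_stable hg hβ ht, ← intervalIntegral.integral_sub hi1 hi2]
  refine intervalIntegral.integral_congr fun s hs => ?_
  rw [uIcc_of_le ht] at hs
  rw [← smul_sub, ← S.expLs_sub hl hβ hg (sub_nonneg.2 hs.2), E2]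
  congr 2
  abel

end SurrogatePath

end Setting

end Pitchfork

namespace Pitchfork

namespace Setting

variable {H V : Type*} [NormedAddCommGroup H] [InnerProductSpace ℝ H] [CompleteSpace H]
  [NormedAddCommGroup V] [NormedSpace ℝ V] [CompleteSpace V] (S : Setting H V)

theorem norm_B_le (u v : V) : ‖S.B u v‖ ≤ ‖S.B‖ * ‖u‖ * ‖v‖ := S.B.le_opNorm₂ u v

theorem abs_Pi1_le {lam : ℝ} (hl : lam ∈ S.Lam) (u : H) : |S.Pi1 lam u| ≤ ‖u‖ := by
  have h := abs_real_inner_le_norm u (S.e lam 0 : H)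
  rwa [S.norm_e hl, mul_one] at h

theorem norm_B_eV_add_le {lam C : ℝ} (hC : ‖S.eV lam 0‖ ≤ C) (v : V) :
    ‖S.B (S.eV lam 0) v + S.B v (S.eV lam 0)‖ ≤ 2 * ‖S.B‖ * C * ‖v‖ := by
  have h1 : ‖S.B (S.eV lam 0) v‖ ≤ ‖S.B‖ * C * ‖v‖ := (S.norm_B_le _ _).trans (by gcongr)
  have h2 : ‖S.B v (S.eV lam 0)‖ ≤ ‖S.B‖ * ‖v‖ * C := (S.norm_B_le _ _).trans (by gcongr)
  refine (norm_add_le _ _).trans ?_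
  linarith

theorem norm_param_le {lam C m : ℝ} (hl : lam ∈ S.Lam) (hm : 0 ≤ m)
    (hC : ∀ n < S.N, ‖S.eV lam n‖ ≤ C) {σ : ℝ} {w : ℝ → ℝ} {t : ℝ}
    (hM : ∀ n, 1 ≤ n → S.M lam σ w n t ≤ m) (x : ℝ) :
    ‖S.param lam σ w x t‖ ≤ S.N * (‖S.B‖ * C ^ 3 * m * x ^ 2) := by
  have h0 := hC 0 (by have := S.one_lt_N; omega)
  have hC0 : 0 ≤ C := (norm_nonneg _).trans h0
  have hterm : ∀ n ∈ Finset.Ico 1 S.N,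
      ‖(S.Bcoef lam n 0 0 * S.M lam σ w n t * x ^ 2) • S.eV lam n‖ ≤ ‖S.B‖ * C ^ 3 * m * x ^ 2 := by
    intro n hn
    rw [Finset.mem_Ico] at hn
    have hb : |S.Bcoef lam n 0 0| ≤ ‖S.B‖ * C * C := by
      have h := abs_real_inner_le_norm (S.B (S.eV lam 0) (S.eV lam 0)) (S.e lam n : H)
      rw [S.norm_e hl, mul_one] at h
      exact h.trans ((S.norm_B_le _ _).trans (by gcongr))
    rw [norm_smul, Real.norm_eq_abs, abs_mul, abs_mul, abs_of_nonneg (S.M_nonneg _ _ _ _ _),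
      abs_of_nonneg (sq_nonneg x)]
    calc |S.Bcoef lam n 0 0| * S.M lam σ w n t * x ^ 2 * ‖S.eV lam n‖
        ≤ (‖S.B‖ * C * C) * m * x ^ 2 * C := by
          gcongr
          · exact S.M_nonneg _ _ _ _ _
          · exact hM n hn.1
          · exact hC n hn.2
      _ = ‖S.B‖ * C ^ 3 * m * x ^ 2 := by ring
  refine (norm_sum_le_of_le _ hterm).trans ?_
  rw [Finset.sum_const, nsmul_eq_mul, Nat.card_Ico]
  gcongr
  exact Nat.sub_le _ _

/-- Size of the solutions of the surrogate system on the time scale `1 / ε`. -/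
theorem exists_size_bound (K T c : ℝ) : ∃ D F, 0 < D ∧ 0 < F ∧ ∀ lam w x φ,
    S.SurrogatePath lam K w x φ → |x 0| ≤ c * Real.sqrt (S.eps lam) →
    ∀ t ∈ Icc 0 (T / S.eps lam), |x t| ≤ D * Real.sqrt (S.eps lam) ∧ ‖φ t‖ ≤ F * S.eps lam := by
  obtain ⟨C, hC, hC'⟩ := S.exists_norm_eV_le
  obtain ⟨g, hg, hg'⟩ := S.exists_spectral_gap
  set D := Real.exp (K + 2 * T) * (|c| + 1) with hD
  set m := Real.exp (2 * K + 2 * T) / g with hm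
  have hD0 : 0 < D := by positivity
  have hm0 : 0 < m := by positivity
  refine ⟨D, S.N * (‖S.B‖ * C ^ 3 * m * D ^ 2) + 1, hD0, by positivity,
    fun lam w x φ h hx t ht => ?_⟩
  have hε := h.eps_pos
  have htT : S.eps lam * t ≤ T := by
    rw [mul_comm]
    exact (le_div_iff₀ hε).1 ht.2
  have h1 : |x t| ≤ D * Real.sqrt (S.eps lam) := by
    refine (h.abs_x_le ht.1).trans ?_
    rw [hD, mul_assoc]
    have h2 : |x 0| ≤ (|c| + 1) * Real.sqrt (S.eps lam) :=
      hx.trans (by gcongr; linarith [le_abs_self c])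
    gcongr
  refine ⟨h1, ?_⟩
  rw [h.eq_param ht.1]
  refine (S.norm_param_le h.mem_Lam hm0.le (hC' lam h.mem_Icc) (m := m) (fun n hn => ?_) (x t)).trans ?_
  · refine (S.M_le h.good hg hε.le (hg' lam h.mem_Icc n hn) ht.1).trans ?_
    rw [hm]
    gcongr
  · have h3 : x t ^ 2 ≤ D ^ 2 * S.eps lam := by
      rw [← sq_abs]
      refine (pow_le_pow_left₀ (abs_nonneg _) h1 2).trans_eq ?_
      rw [mul_pow, Real.sq_sqrt hε.le]
    calc S.N * (‖S.B‖ * C ^ 3 * m * x t ^ 2)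
        ≤ S.N * (‖S.B‖ * C ^ 3 * m * (D ^ 2 * S.eps lam)) := by gcongr
      _ = (S.N * (‖S.B‖ * C ^ 3 * m * D ^ 2)) * S.eps lam := by ring
      _ ≤ _ := by gcongr; linarith

theorem exp_noise_sub_le {lam K T : ℝ} {w x : ℝ → ℝ} {φ : ℝ → V}
    (h : S.SurrogatePath lam K w x φ) {s t : ℝ} (hs : 0 ≤ s) (hst : s ≤ t)
    (ht : t ≤ T / S.eps lam) :
    Real.sqrt (S.eps lam) * (w t - w s) ≤ 2 * (K + T) := by
  have hε := h.eps_pos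
  have htT : S.eps lam * t ≤ T := by
    rw [mul_comm]
    exact (le_div_iff₀ hε).1 ht
  have hsT : S.eps lam * s ≤ S.eps lam * t := by gcongr
  have h1 := (le_abs_self _).trans (h.good.sigma_le (hs.trans hst))
  have h2 := (neg_le_abs _).trans (h.good.sigma_le hs)
  linarith

theorem exists_R1_bound (K T c : ℝ) (hT : 0 < T) : ∃ C, 0 < C ∧ ∀ lam w x φ,
    S.SurrogatePath lam K w x φ → |x 0| ≤ c * Real.sqrt (S.eps lam) →
    ∀ t ∈ Icc 0 (T / S.eps lam),
      |S.R1 lam (Real.sqrt (S.eps lam)) w x φ t| ≤ C * S.eps lam := by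
  obtain ⟨D, F, hD, hF, hDF⟩ := S.exists_size_bound K T c
  set Q := Real.exp (T + 2 * (K + T)) with hQ
  have hQ0 : 0 < Q := Real.exp_pos _
  refine ⟨Q * (‖S.B‖ * F ^ 2) * T + 1, by positivity, fun lam w x φ h hx t ht => ?_⟩
  have hε := h.eps_pos
  rw [h.R1_eq ht.1, abs_neg, ← Real.norm_eq_abs]
  have hbound : ∀ s ∈ uIoc 0 t,
      ‖Real.exp (S.eps lam * (t - s) + Real.sqrt (S.eps lam) * (w t - w s)) *
        S.Pi1 lam (S.B (φ s) (φ s))‖ ≤ Q * (‖S.B‖ * (F * S.eps lam) * (F * S.eps lam)) := by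
    intro s hs
    rw [uIoc_of_le ht.1] at hs
    have hφ := (hDF lam w x φ h hx s ⟨hs.1.le, hs.2.trans ht.2⟩).2
    rw [norm_mul, Real.norm_eq_abs, Real.abs_exp, Real.norm_eq_abs]
    have h1 : S.eps lam * (t - s) ≤ T := by
      have : S.eps lam * t ≤ T := by
        rw [mul_comm]
        exact (le_div_iff₀ hε).1 ht.2
      nlinarith [mul_pos hε hs.1]
    have h2 := S.exp_noise_sub_le h hs.1.le hs.2 ht.2
    have h3 : |S.Pi1 lam (S.B (φ s) (φ s))| ≤ ‖S.B‖ * (F * S.eps lam) * (F * S.eps lam) :=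
      (S.abs_Pi1_le h.mem_Lam _).trans ((S.norm_B_le _ _).trans (by gcongr))
    have h4 : Real.exp (S.eps lam * (t - s) + Real.sqrt (S.eps lam) * (w t - w s)) ≤ Q :=
      Real.exp_le_exp.2 (add_le_add h1 h2)
    gcongr
  refine (intervalIntegral.norm_integral_le_of_norm_le_const hbound).trans ?_
  rw [sub_zero, abs_of_nonneg ht.1]
  calc Q * (‖S.B‖ * (F * S.eps lam) * (F * S.eps lam)) * t
      ≤ Q * (‖S.B‖ * (F * S.eps lam) * (F * S.eps lam)) * (T / S.eps lam) := by
        gcongr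
        exact ht.2
    _ = Q * (‖S.B‖ * F ^ 2) * T * S.eps lam := by field_simp
    _ ≤ _ := by gcongr; linarith

theorem rpow_three_halves {a : ℝ} (ha : 0 < a) : a ^ (3 / 2 : ℝ) = a * Real.sqrt a := by
  rw [show (3 / 2 : ℝ) = 1 + 1 / 2 by norm_num, Real.rpow_add ha, Real.rpow_one,
    Real.sqrt_eq_rpow]

theorem exists_defect_bound (K T c : ℝ) : ∃ G, 0 < G ∧ ∀ lam w x φ,
    S.SurrogatePath lam K w x φ → |x 0| ≤ c * Real.sqrt (S.eps lam) →
    ∀ t ∈ Icc 0 (T / S.eps lam),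
      ‖(2 * S.Fc lam (φ t)) • S.emb (φ t) - (x t • S.Fs lam (φ t) + S.Pis lam (S.B (φ t) (φ t)))‖
        ≤ G * S.eps lam ^ (3 / 2 : ℝ) := by
  obtain ⟨C, hC, hC'⟩ := S.exists_norm_eV_le
  obtain ⟨E, hE, hE'⟩ := S.exists_eps_le
  obtain ⟨D, F, hD, hF, hDF⟩ := S.exists_size_bound K T c
  set b := ‖S.B‖ with hb
  have hb0 : 0 ≤ b := norm_nonneg S.B
  set A := 4 * b * C * F ^ 2 * ‖S.emb‖ + 2 * b * F ^ 2 with hA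
  have hA0 : 0 ≤ A := by positivity
  refine ⟨A * Real.sqrt E + 4 * b * C * D * F + 1, by positivity, fun lam w x φ h hx t ht => ?_⟩
  have hε := h.eps_pos
  obtain ⟨h1, h2⟩ := hDF lam w x φ h hx t ht
  have hC0 := hC' lam h.mem_Icc 0 (by have := S.one_lt_N; omega)
  have hl := h.mem_Lam
  set ε := S.eps lam with hεdef
  have hFc : |S.Fc lam (φ t)| ≤ 2 * b * C * (F * ε) :=
    (S.abs_Pi1_le hl _).trans ((S.norm_B_eV_add_le hC0 _).trans (by gcongr))
  have hFs : ‖S.Fs lam (φ t)‖ ≤ 2 * (2 * b * C * (F * ε)) :=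
    (S.norm_Pis_le hl _).trans
      (mul_le_mul_of_nonneg_left ((S.norm_B_eV_add_le hC0 _).trans (by gcongr)) two_pos.le)
  have hPs : ‖S.Pis lam (S.B (φ t) (φ t))‖ ≤ 2 * (b * (F * ε) * (F * ε)) :=
    (S.norm_Pis_le hl _).trans
      (mul_le_mul_of_nonneg_left ((S.norm_B_le _ _).trans (by gcongr)) two_pos.le)
  have hemb : ‖S.emb (φ t)‖ ≤ ‖S.emb‖ * (F * ε) := (S.emb.le_opNorm _).trans (by gcongr)
  have hsqE : Real.sqrt ε ≤ Real.sqrt E := Real.sqrt_le_sqrt (hE' lam h.mem_Icc)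
  have hsq : Real.sqrt ε * Real.sqrt ε = ε := Real.mul_self_sqrt hε.le
  have hsum := norm_add_le (x t • S.Fs lam (φ t)) (S.Pis lam (S.B (φ t) (φ t)))
  refine (norm_sub_le _ _).trans ((add_le_add le_rfl hsum).trans ?_)
  rw [norm_smul, norm_smul, Real.norm_eq_abs, Real.norm_eq_abs, abs_mul, abs_two,
    rpow_three_halves hε]
  calc 2 * |S.Fc lam (φ t)| * ‖S.emb (φ t)‖ +
        (|x t| * ‖S.Fs lam (φ t)‖ + ‖S.Pis lam (S.B (φ t) (φ t))‖)
      ≤ 2 * (2 * b * C * (F * ε)) * (‖S.emb‖ * (F * ε)) +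
        (D * Real.sqrt ε * (2 * (2 * b * C * (F * ε))) + 2 * (b * (F * ε) * (F * ε))) := by
        gcongr
    _ = A * (ε * ε) + 4 * b * C * D * F * (ε * Real.sqrt ε) := by rw [hA]; ring
    _ = A * (ε * (Real.sqrt ε * Real.sqrt ε)) + 4 * b * C * D * F * (ε * Real.sqrt ε) := by
        rw [hsq]
    _ ≤ A * (ε * (Real.sqrt E * Real.sqrt ε)) + 4 * b * C * D * F * (ε * Real.sqrt ε) := by
        gcongr
    _ = (A * Real.sqrt E + 4 * b * C * D * F) * (ε * Real.sqrt ε) := by ring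
    _ ≤ _ := mul_le_mul_of_nonneg_right (le_add_of_nonneg_right one_pos.le) (by positivity)

theorem exists_R2_bound (K T c : ℝ) : ∃ C, 0 < C ∧ ∀ lam w x φ,
    S.SurrogatePath lam K w x φ → |x 0| ≤ c * Real.sqrt (S.eps lam) →
    ∀ t ∈ Icc 0 (T / S.eps lam),
      ‖S.R2 lam (Real.sqrt (S.eps lam)) w x φ t‖ ≤ C * S.eps lam ^ (3 / 2 : ℝ) := by
  obtain ⟨g, hg, hg'⟩ := S.exists_spectral_gap
  obtain ⟨G, hG, hG'⟩ := S.exists_defect_bound K T c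
  set Q := Real.exp (2 * (K + T)) with hQ
  have hQ0 : 0 < Q := Real.exp_pos _
  refine ⟨Q * G / g, by positivity, fun lam w x φ h hx t ht => ?_⟩
  have hε := h.eps_pos
  have hβ := hg' lam h.mem_Icc
  rw [h.R2_eq hg.le hβ ht.1]
  set δ := S.eps lam ^ (3 / 2 : ℝ) with hδ
  have hδ0 : 0 < δ := Real.rpow_pos_of_pos hε _
  have hbound : ∀ s, s ∈ Ioc 0 t →
      ‖Real.exp (Real.sqrt (S.eps lam) * (w t - w s)) • S.expLs lam (t - s)
        ((2 * S.Fc lam (φ s)) • S.emb (φ s) -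
          (x s • S.Fs lam (φ s) + S.Pis lam (S.B (φ s) (φ s))))‖ ≤
        Q * (G * δ) * Real.exp (-g * (t - s)) := by
    intro s hs
    have h1 := hG' lam w x φ h hx s ⟨hs.1.le, hs.2.trans ht.2⟩
    have h2 : Real.exp (Real.sqrt (S.eps lam) * (w t - w s)) ≤ Q :=
      Real.exp_le_exp.2 (S.exp_noise_sub_le h hs.1.le hs.2 ht.2)
    rw [norm_smul, Real.norm_eq_abs, Real.abs_exp, mul_assoc]
    gcongr
    refine (S.norm_expLs_le h.mem_Lam hβ hg.le (sub_nonneg.2 hs.2) _).trans ?_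
    rw [mul_comm]
    gcongr
  have hcont : Continuous fun s => Q * (G * δ) * Real.exp (-g * (t - s)) := by fun_prop
  refine (intervalIntegral.norm_integral_le_of_norm_le ht.1 (Eventually.of_forall hbound)
    (hcont.intervalIntegrable _ _)).trans ?_
  have hprim : ∀ s ∈ uIcc 0 t, HasDerivAt (fun s => Real.exp (-g * (t - s)) / g)
      (Real.exp (-g * (t - s))) s := by
    intro s _
    convert! ((((hasDerivAt_id s).const_sub t).const_mul (-g)).exp).div_const g using 1
    simp only [id]
    field_simp
  rw [intervalIntegral.integral_const_mul, intervalIntegral.integral_eq_sub_of_hasDerivAt hprim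
    (Continuous.intervalIntegrable (by fun_prop) _ _), sub_self, mul_zero, Real.exp_zero]
  have h3 : 0 ≤ Real.exp (-g * (t - 0)) / g := by positivity
  calc Q * (G * δ) * (1 / g - Real.exp (-g * (t - 0)) / g) ≤ Q * (G * δ) * (1 / g) := by
        gcongr
        linarith
    _ = Q * G / g * δ := by ring

end Setting

theorem one_sub_le_real_of_compl_le {Ω : Type*} [MeasurableSpace Ω] {Pr : Measure Ω}
    [IsProbabilityMeasure Pr] {s bad : Set Ω} {d : ℝ} (hd : 0 ≤ d)
    (hbad : Pr bad ≤ ENNReal.ofReal d) (h : ∀ᵐ ω ∂Pr, ω ∉ bad → ω ∈ s) : 1 - d ≤ Pr.real s := by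
  have h1 : Pr.real sᶜ ≤ d := by
    refine ENNReal.toReal_le_of_le_ofReal hd ((measure_mono_ae ?_).trans hbad)
    filter_upwards [h] with ω hω hs
    by_contra hb
    exact hs (hω hb)
  have h2 := measureReal_union_le (μ := Pr) s sᶜ
  rw [union_compl_self, probReal_univ] at h2
  linarith

end Pitchfork

theorem theorem3p1 {H V : Type*}
    [NormedAddCommGroup H] [InnerProductSpace ℝ H] [CompleteSpace H]
    [NormedAddCommGroup V] [NormedSpace ℝ V] [CompleteSpace V]
    (S : Pitchfork.Setting H V)
    {Ω : Type*} [MeasurableSpace Ω] (Pr : Measure Ω) [IsProbabilityMeasure Pr]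
    (W : ℝ → Ω → ℝ) (hW : Pitchfork.IsTwoSidedBrownian W Pr)
    (hdiss : ∀ lam ∈ Icc S.lamC S.lamStar,
      ∀ᵐ ω ∂Pr, S.Dissipative lam (Real.sqrt (S.eps lam)) (W · ω))
    (c T χ : ℝ) (hT : 0 < T) (hχ : χ ∈ Ioo (0 : ℝ) 1) :
    ∃ C : ℝ, 0 < C ∧
      ∀ lam ∈ Ioc S.lamC S.lamStar, ∀ X₀ : ℝ, |X₀| ≤ c * Real.sqrt (S.eps lam) →
        ∀ (X : ℝ → Ω → ℝ) (Φ : ℝ → Ω → V),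
          S.IsSurrogateSolution lam Pr W (Real.sqrt (S.eps lam)) X₀ X Φ →
          1 - χ ≤ Pr.real {ω | ∀ t ∈ Icc 0 (T / S.eps lam),
              |S.R1 lam (Real.sqrt (S.eps lam)) (W · ω) (X · ω) (Φ · ω) t| ≤ C * S.eps lam} ∧
          1 - χ ≤ Pr.real {ω | ∀ t ∈ Icc 0 (T / S.eps lam),
              ‖S.R2 lam (Real.sqrt (S.eps lam)) (W · ω) (X · ω) (Φ · ω) t‖
                ≤ C * S.eps lam ^ (3 / 2 : ℝ)} := by
  obtain ⟨K, -, hK⟩ := Pitchfork.exists_measure_not_goodPath_le hW hχ.1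
  obtain ⟨C₁, hC₁, h₁⟩ := S.exists_R1_bound K T c hT
  obtain ⟨C₂, hC₂, h₂⟩ := S.exists_R2_bound K T c
  refine ⟨max C₁ C₂, lt_max_of_lt_left hC₁, fun lam hlam X₀ hX₀ X Φ hsol => ?_⟩
  have hI : lam ∈ Icc S.lamC S.lamStar := ⟨hlam.1.le, hlam.2⟩
  have hε : 0 < S.eps lam := S.critical_pos lam (S.Lam_of_Icc hI) hlam.1
  have hpath : ∀ᵐ ω ∂Pr, ω ∉ {ω | ¬ Pitchfork.GoodPath (S.eps lam) K (W · ω)} →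
      S.SurrogatePath lam K (W · ω) (X · ω) (Φ · ω) ∧
        |X 0 ω| ≤ c * Real.sqrt (S.eps lam) := by
    filter_upwards [hsol, hdiss lam hI] with ω hω hd hgood
    refine ⟨⟨hlam, not_not.1 hgood, hd, hω.1, ?_⟩, by rwa [hω.2.1]⟩
    rw [hω.2.2, hω.2.1]
  constructor
  · refine Pitchfork.one_sub_le_real_of_compl_le hχ.1.le (hK _ hε) ?_
    filter_upwards [hpath] with ω hω hgood t ht
    refine (h₁ lam _ _ _ (hω hgood).1 (hω hgood).2 t ht).trans ?_
    gcongr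
    exact le_max_left _ _
  · refine Pitchfork.one_sub_le_real_of_compl_le hχ.1.le (hK _ hε) ?_
    filter_upwards [hpath] with ω hω hgood t ht
    refine (h₂ lam _ _ _ (hω hgood).1 (hω hgood).2 t ht).trans ?_
    have : 0 ≤ S.eps lam ^ (3 / 2 : ℝ) := Real.rpow_nonneg hε.le _
    gcongr
    exact le_max_right _ _
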